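/- Let $n\ge 4$ be an even integer, let $u\in C^\infty(\mathbb{R}^n)$ be real-valued, and consider the conformal metric $g=e^{2u}|dx|^2$ on $\mathbb{R}^n$ (not assumed complete). Let $R_g$ be its scalar curvature and let $Q$ be its Q-curvature, that is, the function determined by $(-\Delta)^{n/2}u=Qe^{nu}$ on $\mathbb{R}^n$, where $\Delta$ is the Euclidean Laplacian. Let $|\mathbb{S}^n|$ denote the volume of the unit sphere $\mathbb{S}^n\subset\mathbb{R}^{n+1}$. Assume that $g$ has finite total Q-curvature, i.e. $Qe^{nu}\in L^1(\mathbb{R}^n)$, and that there are a constant $C$ and a compact set $K\subset\mathbb{R}^n$ such that $0\le R_g\le C$ on $\mathbb{R}^n\setminus K$. Then: 1. Either $$0\le\int_{\mathbb{R}^n}Qe^{nu}\,dx\le\frac{(n-1)!\,|\mathbb{S}^n|}{2}\qquad\text{or}\qquad\int_{\mathbb{R}^n}Qe^{nu}\,dx=(n-1)!\,|\mathbb{S}^n|.$$ 2. If in addition the volume of $g$ is finite, i.e. $e^{nu}\in L^1(\mathbb{R}^n)$, then $$\int_{\mathbb{R}^n}Qe^{nu}\,dx=(n-1)!\,|\mathbb{S}^n|.$$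 -/

import Mathlib

open MeasureTheory
open scoped ContDiff

noncomputable section

namespace ConformalQ

/-- Euclidean space `ℝⁿ`. -/
abbrev E (n : ℕ) : Type := EuclideanSpace ℝ (Fin n)

/-- The partial derivative `∂ᵢ f` at `x` in the standard coordinates of `ℝⁿ`. -/
def partialDeriv {n : ℕ} (i : Fin n) (f : E n → ℝ) (x : E n) : ℝ :=
  fderiv ℝ f x (EuclideanSpace.single i 1)

/-- The Christoffel symbol `Γᵏᵢⱼ = ½ ∑ₗ gᵏˡ (∂ᵢ gⱼₗ + ∂ⱼ gᵢₗ - ∂ₗ gᵢⱼ)` of a metric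
`g = (gᵢⱼ)` on `ℝⁿ`, given by its components in the standard coordinates. -/
def christoffel {n : ℕ} (g : E n → Matrix (Fin n) (Fin n) ℝ) (k i j : Fin n) (x : E n) : ℝ :=
  (1 / 2 : ℝ) * ∑ l, (g x)⁻¹ k l *
    (partialDeriv i (fun y => g y j l) x + partialDeriv j (fun y => g y i l) x
      - partialDeriv l (fun y => g y i j) x)

/-- The Ricci curvature
`Ricᵢⱼ = ∑ₖ (∂ₖ Γᵏᵢⱼ - ∂ⱼ Γᵏᵢₖ) + ∑ₖ ∑ₗ (Γᵏₖₗ Γˡᵢⱼ - Γᵏⱼₗ Γˡᵢₖ)` of a metric on `ℝⁿ`. -/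
def ricci {n : ℕ} (g : E n → Matrix (Fin n) (Fin n) ℝ) (i j : Fin n) (x : E n) : ℝ :=
  ∑ k, (partialDeriv k (christoffel g k i j) x - partialDeriv j (christoffel g k i k) x)
    + ∑ k, ∑ l, (christoffel g k k l x * christoffel g l i j x
        - christoffel g k j l x * christoffel g l i k x)

/-- The scalar curvature `R = ∑ᵢⱼ gⁱʲ Ricᵢⱼ` of a metric on `ℝⁿ`. -/
def scalarCurvature {n : ℕ} (g : E n → Matrix (Fin n) (Fin n) ℝ) (x : E n) : ℝ :=
  ∑ i, ∑ j, (g x)⁻¹ i j * ricci g i j x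

/-- The conformal metric `e^{2u} |dx|²` on `ℝⁿ`. -/
def conformalMetric {n : ℕ} (u : E n → ℝ) (x : E n) : Matrix (Fin n) (Fin n) ℝ :=
  Real.exp (2 * u x) • (1 : Matrix (Fin n) (Fin n) ℝ)

/-- The iterated operator `(-Δ)ᵐ` on functions on `ℝⁿ`. -/
def negLaplacianPow {n : ℕ} (m : ℕ) (u : E n → ℝ) : E n → ℝ :=
  (fun f : E n → ℝ => -Laplacian.laplacian f)^[m] u

/-- The Q-curvature of the metric `e^{2u} |dx|²` on `ℝⁿ`, `n` even: the unique function `Q` with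
`(-Δ)^{n/2} u = Q e^{nu}`. -/
def qCurvature {n : ℕ} (u : E n → ℝ) (x : E n) : ℝ :=
  Real.exp (-(n * u x)) * negLaplacianPow (n / 2) u x

/-- The volume `|𝕊ⁿ|` of the standard unit sphere in `ℝⁿ⁺¹`. -/
def sphereVolume (n : ℕ) : ℝ :=
  (volume : Measure (E (n + 1))).toSphere.real Set.univ

end ConformalQ

end

/-!
Write `f` for `Q e^{nu}` divided by `(n - 1)! |𝕊ⁿ| / 2`, so that the claim concerns the total mass
`α = ∫ f`. The lower bound on the scalar curvature makes the average of `‖∇ u‖` over the ball of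
radius `R` of order `1 / R`, and a Liouville argument then shows that `∇ u` is the gradient of the
logarithmic potential of `f`. Hence `u (R x)` behaves like `-α log R`, and, since `R_g e^{2u}` is a
combination of `Δ u` and `‖∇ u‖ ^ 2`, its blow-downs `R² (R_g e^{2u}) (R x)` converge weakly away
from the origin to a positive multiple of `(α - α ^ 2 / 2) ‖x‖⁻²`. Since `R_g`
is nonnegative near infinity, `0 ≤ α ≤ 2`.

If `α ≠ 2`, the upper bound on `R_g` turns this limit into a positive lower bound for
`∫_B R² e^{2u(R x)} dx` on a compact set `B` away from the origin; when `α = 0`, the Cauchy-Schwarz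
inequality gives one. If `α > 1` these integrals tend to zero, so that `α ∈ [0, 1] ∪ {2}`. If the
volume is finite, then `∫_B (R² e^{2u(R x)})^{n/2} dx`, which is the volume of `R B`, tends to zero,
so that `α = 2`.
-/

noncomputable section

namespace ConformalQ

open Filter Laplacian Metric Set Topology
open scoped Gradient InnerProductSpace

variable {n : ℕ}

theorem contDiff_partialDeriv (i : Fin n) {f : E n → ℝ} (hf : ContDiff ℝ ∞ f) :
    ContDiff ℝ ∞ (partialDeriv i f) := by
  unfold partialDeriv
  exact (hf.fderiv_right (m := ∞) (by simp)).clm_apply contDiff_const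

theorem hasCompactSupport_partialDeriv (i : Fin n) {f : E n → ℝ} (hf : HasCompactSupport f) :
    HasCompactSupport (partialDeriv i f) :=
  hf.fderiv_apply ℝ _

theorem partialDeriv_partialDeriv (i j : Fin n) {f : E n → ℝ} (hf : ContDiff ℝ ∞ f) (x : E n) :
    partialDeriv i (partialDeriv j f) x
      = fderiv ℝ (fderiv ℝ f) x (EuclideanSpace.single i 1) (EuclideanSpace.single j 1) := by
  have hd : DifferentiableAt ℝ (fderiv ℝ f) x :=
    (hf.fderiv_right (m := ∞) (by simp)).differentiable (by simp) x
  unfold partialDeriv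
  rw [fderiv_clm_apply hd (differentiableAt_const _)]
  simp

theorem partialDeriv_comm (i j : Fin n) {f : E n → ℝ} (hf : ContDiff ℝ ∞ f) :
    partialDeriv i (partialDeriv j f) = partialDeriv j (partialDeriv i f) := by
  ext x
  have hsymm : IsSymmSndFDerivAt ℝ f x := hf.contDiffAt.isSymmSndFDerivAt <| by
    rw [minSmoothness_of_isRCLikeNormedField]
    exact WithTop.coe_le_coe.2 (le_top : (2 : ℕ∞) ≤ ⊤)
  rw [partialDeriv_partialDeriv i j hf, partialDeriv_partialDeriv j i hf, hsymm.eq]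

theorem laplacian_eq_sum {f : E n → ℝ} (hf : ContDiff ℝ ∞ f) :
    Δ f = fun x => ∑ i, partialDeriv i (partialDeriv i f) x := by
  rw [InnerProductSpace.laplacian_eq_iteratedFDeriv_orthonormalBasis f
    (EuclideanSpace.basisFun (Fin n) ℝ)]
  ext x
  refine Finset.sum_congr rfl fun i _ => ?_
  rw [iteratedFDeriv_two_apply, partialDeriv_partialDeriv i i hf]
  simp

theorem contDiff_laplacian {f : E n → ℝ} (hf : ContDiff ℝ ∞ f) : ContDiff ℝ ∞ (Δ f) := by
  rw [laplacian_eq_sum hf]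
  exact ContDiff.sum fun i _ => contDiff_partialDeriv i (contDiff_partialDeriv i hf)

theorem contDiff_iterate_laplacian (m : ℕ) {f : E n → ℝ} (hf : ContDiff ℝ ∞ f) :
    ContDiff ℝ ∞ (Δ^[m] f) := by
  induction m generalizing f with
  | zero => exact hf
  | succ _ ih => exact ih (contDiff_laplacian hf)

theorem laplacian_partialDeriv (i : Fin n) {f : E n → ℝ} (hf : ContDiff ℝ ∞ f) :
    Δ (partialDeriv i f) = partialDeriv i (Δ f) := by
  have hdiff (j : Fin n) : Differentiable ℝ (partialDeriv j (partialDeriv j f)) :=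
    (contDiff_partialDeriv j (contDiff_partialDeriv j hf)).differentiable (by simp)
  have hcomm (j : Fin n) : partialDeriv j (partialDeriv j (partialDeriv i f))
      = partialDeriv i (partialDeriv j (partialDeriv j f)) := by
    rw [partialDeriv_comm j i hf, partialDeriv_comm j i (contDiff_partialDeriv j hf)]
  ext x
  simp only [laplacian_eq_sum hf, laplacian_eq_sum (contDiff_partialDeriv i hf), hcomm]
  rw [partialDeriv, fderiv_fun_sum fun j _ => hdiff j x]
  simp [partialDeriv]

theorem iterate_laplacian_partialDeriv (m : ℕ) (i : Fin n) {f : E n → ℝ} (hf : ContDiff ℝ ∞ f) :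
    Δ^[m] (partialDeriv i f) = partialDeriv i (Δ^[m] f) := by
  induction m generalizing f with
  | zero => rfl
  | succ m ih =>
    rw [Function.iterate_succ_apply, Function.iterate_succ_apply, laplacian_partialDeriv i hf,
      ih (contDiff_laplacian hf)]

theorem negLaplacianPow_eq_iterate_laplacian (m : ℕ) {f : E n → ℝ} (hf : ContDiff ℝ ∞ f) :
    negLaplacianPow m f = (-1 : ℝ) ^ m • Δ^[m] f := by
  induction m with
  | zero => simp [negLaplacianPow]
  | succ m ih =>
    ext x
    have hsmul : Δ ((-1 : ℝ) ^ m • Δ^[m] f) x = (-1) ^ m * Δ (Δ^[m] f) x :=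
      InnerProductSpace.laplacian_smul _
        ((contDiff_iterate_laplacian m hf).of_le (by norm_cast)).contDiffAt
    unfold negLaplacianPow at ih ⊢
    rw [Function.iterate_succ_apply', ih, Pi.neg_apply, hsmul, Function.iterate_succ_apply']
    simp [pow_succ]

section ScalarCurvature

local notation "δ" => (1 : Matrix (Fin _) (Fin _) ℝ)

theorem conformalMetric_apply (u : E n → ℝ) (x : E n) (i j : Fin n) :
    conformalMetric u x i j = δ i j * Real.exp (2 * u x) := by
  simp [conformalMetric, mul_comm]

theorem conformalMetric_inv (u : E n → ℝ) (x : E n) :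
    (conformalMetric u x)⁻¹ = Real.exp (-(2 * u x)) • (1 : Matrix (Fin n) (Fin n) ℝ) := by
  apply Matrix.inv_eq_left_inv
  simp [conformalMetric, smul_smul, ← Real.exp_add]

theorem sum_one_apply_mul (i : Fin n) (f : Fin n → ℝ) : ∑ j, δ i j * f j = f i := by
  simp [Matrix.one_apply]

theorem partialDeriv_conformalMetric {u : E n → ℝ} (hu : ContDiff ℝ ∞ u) (x : E n)
    (i j l : Fin n) : partialDeriv i (fun y => conformalMetric u y j l) x
      = δ j l * (2 * partialDeriv i u x) * Real.exp (2 * u x) := by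
  have hderiv : HasFDerivAt (fun y => δ j l * Real.exp (2 * u y))
      (δ j l • (Real.exp (2 * u x) • ((2 : ℝ) • fderiv ℝ u x))) x :=
    (((hu.differentiable (by simp) x).hasFDerivAt.const_mul 2).exp).const_mul _
  simp only [conformalMetric_apply, partialDeriv, hderiv.fderiv, smul_apply, smul_eq_mul]
  ring

theorem christoffel_conformalMetric {u : E n → ℝ} (hu : ContDiff ℝ ∞ u) (k i j : Fin n) :
    christoffel (conformalMetric u) k i j = fun x =>
      δ j k * partialDeriv i u x + δ i k * partialDeriv j u x - δ i j * partialDeriv k u x := by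
  ext x
  have hterm (l : Fin n) : (Real.exp (-(2 * u x)) • δ) k l *
      (δ j l * (2 * partialDeriv i u x) * Real.exp (2 * u x)
        + δ i l * (2 * partialDeriv j u x) * Real.exp (2 * u x)
        - δ i j * (2 * partialDeriv l u x) * Real.exp (2 * u x))
      = δ k l * (2 * (δ j l * partialDeriv i u x + δ i l * partialDeriv j u x
        - δ i j * partialDeriv l u x)) := by
    rw [Matrix.smul_apply, smul_eq_mul, Real.exp_neg]
    field_simp
  simp only [christoffel, partialDeriv_conformalMetric hu, conformalMetric_inv, hterm,
    sum_one_apply_mul]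
  ring

theorem partialDeriv_christoffel_conformalMetric {u : E n → ℝ} (hu : ContDiff ℝ ∞ u)
    (l k i j : Fin n) (x : E n) : partialDeriv l (christoffel (conformalMetric u) k i j) x =
      δ j k * partialDeriv l (partialDeriv i u) x + δ i k * partialDeriv l (partialDeriv j u) x
        - δ i j * partialDeriv l (partialDeriv k u) x := by
  have hd (a : Fin n) : HasFDerivAt (partialDeriv a u) (fderiv ℝ (partialDeriv a u) x) x :=
    ((contDiff_partialDeriv a hu).differentiable (by simp) x).hasFDerivAt
  have hderiv := (((hd i).const_mul (δ j k)).add ((hd j).const_mul (δ i k))).sub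
    ((hd k).const_mul (δ i j))
  rw [christoffel_conformalMetric hu]
  exact (DFunLike.congr_fun hderiv.fderiv (EuclideanSpace.single l 1)).trans
    (by simp [partialDeriv])

theorem sum_christoffel_mul_christoffel (a : Fin n → ℝ) (i j : Fin n) :
    ∑ k, ∑ l, ((δ l k * a k + δ k k * a l - δ k l * a k)
        * (δ j l * a i + δ i l * a j - δ i j * a l)
      - (δ l k * a j + δ j k * a l - δ j l * a k)
        * (δ k l * a i + δ i l * a k - δ i k * a l))
      = ((n : ℝ) - 2) * (a i * a j - (∑ k, a k ^ 2) * δ i j) := by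
  simp only [Matrix.one_apply, mul_add, add_mul, mul_sub, sub_mul, Finset.sum_add_distrib,
    Finset.sum_sub_distrib, ite_mul, mul_ite, one_mul, zero_mul, mul_zero, Finset.sum_ite_irrel,
    Finset.sum_const_zero, Finset.sum_ite_eq, Finset.sum_ite_eq', Finset.mem_univ, if_true,
    Finset.sum_const, Finset.card_univ, Fintype.card_fin, nsmul_eq_mul, ← pow_two]
  rcases eq_or_ne i j with rfl | hij
  · simp only [add_sub_cancel_left, ↓reduceIte, add_sub_cancel_right, mul_one]
    ring
  · simp only [add_sub_cancel_left, hij, ↓reduceIte, sub_zero, add_sub_cancel_right, hij.symm,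
      add_zero]
    ring

theorem ricci_conformalMetric {u : E n → ℝ} (hu : ContDiff ℝ ∞ u) (i j : Fin n) (x : E n) :
    ricci (conformalMetric u) i j x
      = -((n : ℝ) - 2) * (partialDeriv i (partialDeriv j u) x
          - partialDeriv i u x * partialDeriv j u x)
        - (Δ u x + ((n : ℝ) - 2) * ∑ k, partialDeriv k u x ^ 2) * δ i j := by
  have hlinear : ∑ k, (partialDeriv k (christoffel (conformalMetric u) k i j) x
      - partialDeriv j (christoffel (conformalMetric u) k i k) x)
      = -((n : ℝ) - 2) * partialDeriv i (partialDeriv j u) x - Δ u x * δ i j := by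
    simp only [partialDeriv_christoffel_conformalMetric hu, laplacian_eq_sum hu,
      Finset.sum_add_distrib, Finset.sum_sub_distrib, ← Finset.mul_sum, sum_one_apply_mul]
    rw [partialDeriv_comm j i hu]
    simp only [Matrix.one_apply_eq, one_mul, Finset.sum_const, Finset.card_univ,
      Fintype.card_fin, nsmul_eq_mul, add_sub_cancel_right, neg_sub]
    ring
  rw [ricci, hlinear]
  simp only [christoffel_conformalMetric hu]
  rw [sum_christoffel_mul_christoffel fun k => partialDeriv k u x]
  ring

theorem scalarCurvature_conformalMetric_mul_exp {u : E n → ℝ} (hu : ContDiff ℝ ∞ u) (x : E n) :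
    scalarCurvature (conformalMetric u) x * Real.exp (2 * u x)
      = -(2 * ((n : ℝ) - 1) * Δ u x)
        - ((n : ℝ) - 1) * ((n : ℝ) - 2) * ∑ i, partialDeriv i u x ^ 2 := by
  have htrace : scalarCurvature (conformalMetric u) x
      = Real.exp (-(2 * u x)) * ∑ i, ricci (conformalMetric u) i i x := by
    simp only [scalarCurvature, conformalMetric_inv, Matrix.smul_apply, smul_eq_mul, mul_assoc,
      ← Finset.mul_sum, sum_one_apply_mul]
  rw [htrace, mul_right_comm, ← Real.exp_add, neg_add_cancel, Real.exp_zero, one_mul]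
  simp only [ricci_conformalMetric hu, laplacian_eq_sum hu, Matrix.one_apply_eq,
    Finset.sum_sub_distrib, ← Finset.mul_sum]
  simp only [neg_sub, pow_two, Finset.sum_const, Finset.card_univ, Fintype.card_fin,
    nsmul_eq_mul, mul_one]
  ring

end ScalarCurvature

section Gradient

variable {V : Type*} [NormedAddCommGroup V] [InnerProductSpace ℝ V] [CompleteSpace V]

theorem norm_gradient (f : V → ℝ) (x : V) : ‖∇ f x‖ = ‖fderiv ℝ f x‖ := by
  simp [gradient]

theorem continuous_gradient {m : WithTop ℕ∞} {f : V → ℝ} (hf : ContDiff ℝ m f) (hm : m ≠ 0) :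
    Continuous (∇ f) :=
  (InnerProductSpace.toDual ℝ V).symm.continuous.comp (hf.continuous_fderiv hm)

theorem hasCompactSupport_gradient {f : V → ℝ} (hf : HasCompactSupport f) :
    HasCompactSupport (∇ f) :=
  (hf.fderiv ℝ).comp_left (map_zero (InnerProductSpace.toDual ℝ V).symm)

theorem gradient_comp_smul {f : V → ℝ} (hf : Differentiable ℝ f) (r : ℝ) (x : V) :
    ∇ (fun y => f (r • y)) x = r • ∇ f (r • x) := by
  refine ext_inner_right ℝ fun v => ?_
  have hderiv := (hf (r • x)).hasFDerivAt.comp x ((hasFDerivAt_id x).const_smul r)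
  rw [inner_gradient_left, inner_smul_left, inner_gradient_left]
  exact (DFunLike.congr_fun hderiv.fderiv v).trans (by simp)

theorem gradient_sq {f : V → ℝ} {x : V} (hf : DifferentiableAt ℝ f x) :
    ∇ (fun y => f y ^ 2) x = (2 * f x) • ∇ f x := by
  refine ext_inner_right ℝ fun v => ?_
  rw [inner_gradient_left, inner_smul_left, inner_gradient_left]
  exact (DFunLike.congr_fun (hf.hasFDerivAt.pow 2).fderiv v).trans (by simp)

end Gradient

theorem gradient_apply (f : E n → ℝ) (x : E n) (i : Fin n) : ∇ f x i = partialDeriv i f x := by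
  rw [partialDeriv, ← inner_gradient_left, EuclideanSpace.inner_single_right]
  simp

theorem sum_partialDeriv_mul_partialDeriv (f g : E n → ℝ) (x : E n) :
    ∑ i, partialDeriv i f x * partialDeriv i g x = ⟪∇ f x, ∇ g x⟫_ℝ := by
  simp only [PiLp.inner_apply, gradient_apply, RCLike.inner_apply', conj_trivial]

theorem sum_partialDeriv_sq (f : E n → ℝ) (x : E n) :
    ∑ i, partialDeriv i f x ^ 2 = ‖∇ f x‖ ^ 2 := by
  simp [EuclideanSpace.norm_sq_eq, gradient_apply]

theorem hasCompactSupport_laplacian {f : E n → ℝ} (hf : HasCompactSupport f) :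
    HasCompactSupport (Δ f) := by
  refine hf.mono' fun x hx => ?_
  by_contra hxs
  have hzero : f =ᶠ[𝓝 x] fun _ => 0 := notMem_tsupport_iff_eventuallyEq.1 hxs
  apply hx
  rw [(InnerProductSpace.laplacian_congr_nhds hzero).eq_of_nhds]
  simp [InnerProductSpace.laplacian_const]

theorem integral_mul_partialDeriv (i : Fin n) {h g : E n → ℝ} (hh : ContDiff ℝ ∞ h)
    (hc : HasCompactSupport h) (hg : ContDiff ℝ ∞ g) :
    ∫ x, h x * partialDeriv i g x = -∫ x, partialDeriv i h x * g x := by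
  refine integral_mul_fderiv_eq_neg_fderiv_mul_of_integrable ?_ ?_ ?_
    (fun x _ => hh.differentiable (by simp) x) (fun x _ => hg.differentiable (by simp) x)
  · exact ((contDiff_partialDeriv i hh).mul hg).continuous.integrable_of_hasCompactSupport
      (hasCompactSupport_partialDeriv i hc).mul_right
  · exact (hh.mul (contDiff_partialDeriv i hg)).continuous.integrable_of_hasCompactSupport
      hc.mul_right
  · exact (hh.mul hg).continuous.integrable_of_hasCompactSupport hc.mul_right

theorem integral_mul_laplacian_eq_neg_inner {h g : E n → ℝ} (hh : ContDiff ℝ ∞ h)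
    (hc : HasCompactSupport h) (hg : ContDiff ℝ ∞ g) :
    ∫ x, h x * Δ g x = -∫ x, ⟪∇ h x, ∇ g x⟫_ℝ := by
  simp only [laplacian_eq_sum hg, Finset.mul_sum, ← sum_partialDeriv_mul_partialDeriv]
  rw [integral_finsetSum, integral_finsetSum, ← Finset.sum_neg_distrib]
  · exact Finset.sum_congr rfl fun i _ =>
      integral_mul_partialDeriv i hh hc (contDiff_partialDeriv i hg)
  · intro i _
    exact ((contDiff_partialDeriv i hh).mul
      (contDiff_partialDeriv i hg)).continuous.integrable_of_hasCompactSupport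
      (hasCompactSupport_partialDeriv i hc).mul_right
  · intro i _
    exact (hh.mul (contDiff_partialDeriv i
      (contDiff_partialDeriv i hg))).continuous.integrable_of_hasCompactSupport hc.mul_right

theorem integral_inner_gradient_eq_neg_laplacian_mul {h g : E n → ℝ} (hh : ContDiff ℝ ∞ h)
    (hc : HasCompactSupport h) (hg : ContDiff ℝ ∞ g) :
    ∫ x, ⟪∇ h x, ∇ g x⟫_ℝ = -∫ x, Δ h x * g x := by
  simp only [laplacian_eq_sum hh, Finset.sum_mul, ← sum_partialDeriv_mul_partialDeriv]
  rw [integral_finsetSum, integral_finsetSum, ← Finset.sum_neg_distrib]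
  · exact Finset.sum_congr rfl fun i _ => integral_mul_partialDeriv i
      (contDiff_partialDeriv i hh) (hasCompactSupport_partialDeriv i hc) hg
  · intro i _
    exact ((contDiff_partialDeriv i (contDiff_partialDeriv i hh)).mul
      hg).continuous.integrable_of_hasCompactSupport
      (hasCompactSupport_partialDeriv i (hasCompactSupport_partialDeriv i hc)).mul_right
  · intro i _
    exact ((contDiff_partialDeriv i hh).mul
      (contDiff_partialDeriv i hg)).continuous.integrable_of_hasCompactSupport
      (hasCompactSupport_partialDeriv i hc).mul_right

theorem integral_mul_laplacian {h g : E n → ℝ} (hh : ContDiff ℝ ∞ h)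
    (hc : HasCompactSupport h) (hg : ContDiff ℝ ∞ g) :
    ∫ x, h x * Δ g x = ∫ x, Δ h x * g x := by
  rw [integral_mul_laplacian_eq_neg_inner hh hc hg,
    integral_inner_gradient_eq_neg_laplacian_mul hh hc hg, neg_neg]

theorem integral_mul_iterate_laplacian (m : ℕ) {h g : E n → ℝ} (hh : ContDiff ℝ ∞ h)
    (hc : HasCompactSupport h) (hg : ContDiff ℝ ∞ g) :
    ∫ x, h x * (Δ^[m] g) x = ∫ x, (Δ^[m] h) x * g x := by
  induction m generalizing h with
  | zero => rfl
  | succ m ih =>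
    rw [Function.iterate_succ_apply',
      integral_mul_laplacian hh hc (contDiff_iterate_laplacian m hg),
      ih (contDiff_laplacian hh) (hasCompactSupport_laplacian hc), Function.iterate_succ_apply]

/-- The operator `4 t ψ'' + 2 n ψ'`, which is the Laplacian of `ℝⁿ` acting on radial functions
written in the variable `t = ‖x‖²`; unlike the variable `‖x‖`, it keeps them smooth at the
centre. -/
def radialLaplacian (n : ℕ) (ψ : ℝ → ℝ) (t : ℝ) : ℝ :=
  4 * t * deriv (deriv ψ) t + 2 * n * deriv ψ t

theorem contDiff_deriv {ψ : ℝ → ℝ} (hψ : ContDiff ℝ ∞ ψ) : ContDiff ℝ ∞ (deriv ψ) :=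
  (contDiff_infty_iff_deriv.1 hψ).2

theorem contDiff_radialLaplacian (n : ℕ) {ψ : ℝ → ℝ} (hψ : ContDiff ℝ ∞ ψ) :
    ContDiff ℝ ∞ (radialLaplacian n ψ) := by
  have hψ' := contDiff_deriv hψ
  exact ((contDiff_const.mul contDiff_id).mul (contDiff_deriv hψ')).add (contDiff_const.mul hψ')

theorem contDiff_iterate_radialLaplacian (n m : ℕ) {ψ : ℝ → ℝ} (hψ : ContDiff ℝ ∞ ψ) :
    ContDiff ℝ ∞ ((radialLaplacian n)^[m] ψ) := by
  induction m generalizing ψ with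
  | zero => exact hψ
  | succ _ ih => exact ih (contDiff_radialLaplacian n hψ)

section Radial

variable {V : Type*} [NormedAddCommGroup V] [InnerProductSpace ℝ V]

theorem hasFDerivAt_radial {ψ : ℝ → ℝ} {x y : V} (hψ : DifferentiableAt ℝ ψ (‖y - x‖ ^ 2)) :
    HasFDerivAt (fun y => ψ (‖y - x‖ ^ 2))
      (deriv ψ (‖y - x‖ ^ 2) • ((2 : ℝ) • innerSL ℝ (y - x))) y := by
  have hsq : HasFDerivAt (fun y => ‖y - x‖ ^ 2) ((2 : ℝ) • innerSL ℝ (y - x)) y := by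
    simpa [two_smul] using ((hasFDerivAt_id y).sub_const x).norm_sq
  exact hψ.hasDerivAt.comp_hasFDerivAt y hsq

theorem contDiff_radial {m : WithTop ℕ∞} {ψ : ℝ → ℝ} (hψ : ContDiff ℝ m ψ) (x : V) :
    ContDiff ℝ m (fun y => ψ (‖y - x‖ ^ 2)) :=
  hψ.comp ((contDiff_id.sub contDiff_const).norm_sq ℝ)

end Radial

theorem partialDeriv_radial (i : Fin n) {ψ : ℝ → ℝ} (hψ : Differentiable ℝ ψ) (x y : E n) :
    partialDeriv i (fun y => ψ (‖y - x‖ ^ 2)) y = 2 * (y - x) i * deriv ψ (‖y - x‖ ^ 2) := by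
  rw [partialDeriv, (hasFDerivAt_radial (hψ _)).fderiv]
  simp only [map_sub, smul_apply, sub_apply, coe_innerSL_apply, EuclideanSpace.inner_single_right,
    Real.ringHom_apply, one_mul, smul_eq_mul, PiLp.sub_apply]
  ring

theorem partialDeriv_partialDeriv_radial (i : Fin n) {ψ : ℝ → ℝ} (hψ : Differentiable ℝ ψ)
    (hψ' : Differentiable ℝ (deriv ψ)) (x y : E n) :
    partialDeriv i (partialDeriv i fun y => ψ (‖y - x‖ ^ 2)) y
      = 2 * deriv ψ (‖y - x‖ ^ 2) + 4 * (y - x) i ^ 2 * deriv (deriv ψ) (‖y - x‖ ^ 2) := by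
  have hcoord : HasFDerivAt (fun y : E n => 2 * (y - x) i)
      ((2 : ℝ) • (EuclideanSpace.proj i : E n →L[ℝ] ℝ)) y :=
    (((EuclideanSpace.proj i : E n →L[ℝ] ℝ).hasFDerivAt (x := y - x)).comp y
      ((hasFDerivAt_id y).sub_const x)).const_mul 2
  have hmul := DFunLike.congr_fun (hcoord.mul (hasFDerivAt_radial (x := x) (hψ' _))).fderiv
    (EuclideanSpace.single i 1)
  rw [funext (partialDeriv_radial i hψ x)]
  refine hmul.trans ?_
  simp only [PiLp.sub_apply, map_sub, add_apply, smul_apply, sub_apply, coe_innerSL_apply,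
    EuclideanSpace.inner_single_right, Real.ringHom_apply, one_mul, smul_eq_mul, PiLp.proj_apply,
    PiLp.single_eq_same, mul_one]
  ring

theorem laplacian_radial {ψ : ℝ → ℝ} (hψ : ContDiff ℝ ∞ ψ) (x : E n) :
    Δ (fun y => ψ (‖y - x‖ ^ 2)) = fun y => radialLaplacian n ψ (‖y - x‖ ^ 2) := by
  rw [laplacian_eq_sum (contDiff_radial hψ x)]
  ext y
  simp only [partialDeriv_partialDeriv_radial _ (hψ.differentiable (by simp))
    ((contDiff_deriv hψ).differentiable (by simp)), radialLaplacian, Finset.sum_add_distrib,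
    ← Finset.sum_mul, ← Finset.mul_sum]
  rw [EuclideanSpace.norm_sq_eq]
  simp only [Finset.sum_const, Finset.card_univ, Fintype.card_fin, nsmul_eq_mul, PiLp.sub_apply,
    Real.norm_eq_abs, sq_abs]
  ring

theorem iterate_laplacian_radial (m : ℕ) {ψ : ℝ → ℝ} (hψ : ContDiff ℝ ∞ ψ) (x : E n) :
    Δ^[m] (fun y => ψ (‖y - x‖ ^ 2)) = fun y => ((radialLaplacian n)^[m] ψ) (‖y - x‖ ^ 2) := by
  induction m generalizing ψ with
  | zero => rfl
  | succ m ih =>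
    rw [Function.iterate_succ_apply, laplacian_radial hψ, ih (contDiff_radialLaplacian n hψ),
      Function.iterate_succ_apply]

theorem exists_cutoff (n : ℕ) : ∃ M : ℝ, ∀ R : ℝ, 0 < R → ∃ ζ : E n → ℝ,
    ContDiff ℝ ∞ ζ ∧ (∀ x, ζ x ∈ Icc 0 1) ∧ tsupport ζ ⊆ closedBall 0 (2 * R) ∧
      EqOn ζ 1 (closedBall 0 R) ∧ ∀ x, ‖∇ ζ x‖ ≤ M / R := by
  obtain ⟨η, hηIn, hηOut⟩ : ∃ η : ContDiffBump (0 : E n), η.rIn = 1 ∧ η.rOut = 2 :=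
    ⟨⟨1, 2, by norm_num, by norm_num⟩, rfl, rfl⟩
  have hη : ContDiff ℝ ∞ (η : E n → ℝ) := η.contDiff
  obtain ⟨M, hM⟩ := (continuous_gradient hη (by simp)).bounded_above_of_compact_support
    (hasCompactSupport_gradient η.hasCompactSupport)
  refine ⟨M, fun R hR => ⟨fun x => η (R⁻¹ • x), hη.comp (contDiff_const_smul _),
    fun x => ⟨η.nonneg, η.le_one⟩, ?_, ?_, ?_⟩⟩
  · refine closure_minimal (fun x hx => ?_) isClosed_closedBall
    have hmem : R⁻¹ • x ∈ ball (0 : E n) η.rOut := by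
      rw [← η.support_eq]
      exact hx
    rw [mem_ball_zero_iff, norm_smul, norm_inv, Real.norm_of_nonneg hR.le, inv_mul_lt_iff₀ hR,
      hηOut] at hmem
    rw [mem_closedBall_zero_iff]
    linarith
  · intro x hx
    rw [mem_closedBall_zero_iff] at hx
    refine η.one_of_mem_closedBall ?_
    rw [mem_closedBall_zero_iff, norm_smul, norm_inv, Real.norm_of_nonneg hR.le,
      inv_mul_le_iff₀ hR, hηIn]
    linarith
  · intro x
    rw [gradient_comp_smul (hη.differentiable (by simp)), norm_smul, norm_inv,
      Real.norm_of_nonneg hR.le, div_eq_inv_mul]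
    exact mul_le_mul_of_nonneg_left (hM _) (inv_nonneg.2 hR.le)

theorem inner_gradient_sq_le {V : Type*} [NormedAddCommGroup V] [InnerProductSpace ℝ V]
    [CompleteSpace V] {ζ : V → ℝ} {x : V} (hζ : DifferentiableAt ℝ ζ x) (v : V) :
    ⟪∇ (fun y => ζ y ^ 2) x, v⟫_ℝ ≤ 1 / 2 * (ζ x ^ 2 * ‖v‖ ^ 2) + 2 * ‖∇ ζ x‖ ^ 2 := by
  have hcauchy : ζ x * ⟪∇ ζ x, v⟫_ℝ ≤ |ζ x| * (‖∇ ζ x‖ * ‖v‖) := by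
    refine (le_abs_self _).trans ?_
    rw [abs_mul]
    gcongr
    exact abs_real_inner_le_norm _ _
  rw [gradient_sq hζ, real_inner_smul_left]
  nlinarith [sq_nonneg (|ζ x| * ‖v‖ - 2 * ‖∇ ζ x‖), sq_abs (ζ x)]

theorem integral_sq_mul_norm_gradient_sq_le {u ζ : E n → ℝ} (hu : ContDiff ℝ ∞ u)
    (hζ : ContDiff ℝ ∞ ζ) (hc : HasCompactSupport ζ) :
    ∫ x, ζ x ^ 2 * ‖∇ u x‖ ^ 2
      ≤ 2 * (∫ x, ζ x ^ 2 * (‖∇ u x‖ ^ 2 + Δ u x)) + 4 * ∫ x, ‖∇ ζ x‖ ^ 2 := by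
  have hcu := continuous_gradient hu (by simp)
  have hcζ := continuous_gradient hζ (by simp)
  have hc2 : HasCompactSupport fun x => ζ x ^ 2 := hc.comp_left (zero_pow two_ne_zero)
  have hgrad : Integrable fun x => ζ x ^ 2 * ‖∇ u x‖ ^ 2 :=
    ((hζ.continuous.pow 2).mul (hcu.norm.pow 2)).integrable_of_hasCompactSupport hc2.mul_right
  have hlap : Integrable fun x => ζ x ^ 2 * Δ u x :=
    ((hζ.continuous.pow 2).mul
      (contDiff_laplacian hu).continuous).integrable_of_hasCompactSupport hc2.mul_right
  have hgradζ : Integrable fun x => ‖∇ ζ x‖ ^ 2 :=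
    (hcζ.norm.pow 2).integrable_of_hasCompactSupport
      ((hasCompactSupport_gradient hc).mono fun x hx h0 => hx (by simp [h0]))
  have hinner : Integrable fun x => ⟪∇ (fun y => ζ y ^ 2) x, ∇ u x⟫_ℝ :=
    ((continuous_gradient (hζ.pow 2) (by simp)).inner hcu).integrable_of_hasCompactSupport
      ((hasCompactSupport_gradient hc2).mono fun x hx h0 => hx (by simp [h0]))
  have hyoung : ∫ x, ⟪∇ (fun y => ζ y ^ 2) x, ∇ u x⟫_ℝ
      ≤ ∫ x, (1 / 2 * (ζ x ^ 2 * ‖∇ u x‖ ^ 2) + 2 * ‖∇ ζ x‖ ^ 2) :=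
    integral_mono hinner ((hgrad.const_mul (1 / 2)).add (hgradζ.const_mul 2))
      fun x => inner_gradient_sq_le (hζ.differentiable (by simp) x) (∇ u x)
  rw [integral_add (hgrad.const_mul _) (hgradζ.const_mul _), integral_const_mul,
    integral_const_mul] at hyoung
  have hparts := integral_mul_laplacian_eq_neg_inner (hζ.pow 2) hc2 hu
  simp only [mul_add]
  rw [integral_add hgrad hlap]
  linarith

theorem setIntegral_closedBall_le {f : E n → ℝ} {R b : ℝ} (hR : 0 ≤ R)
    (hf : ∀ x ∈ closedBall (0 : E n) R, |f x| ≤ b) :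
    ∫ x in closedBall 0 R, f x ≤ b * (R ^ n * volume.real (ball (0 : E n) 1)) := by
  have h := norm_setIntegral_le_of_norm_le_const (μ := volume) (f := f) measure_closedBall_lt_top hf
  rw [Measure.addHaar_real_closedBall _ _ hR, finrank_euclideanSpace_fin] at h
  exact (le_abs_self _).trans h

theorem integral_norm_gradient_sq_cutoff_le {ζ : E n → ℝ} {r b : ℝ} (hr : 0 ≤ r)
    (hsupp : tsupport ζ ⊆ closedBall 0 r) (hb : ∀ x, ‖∇ ζ x‖ ≤ b) :
    ∫ x, ‖∇ ζ x‖ ^ 2 ≤ b ^ 2 * (r ^ n * volume.real (ball (0 : E n) 1)) := by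
  have hzero : ∀ x, x ∉ closedBall (0 : E n) r → ‖∇ ζ x‖ ^ 2 = 0 := fun x hx => by
    rw [norm_gradient, fderiv_of_notMem_tsupport ℝ fun h => hx (hsupp h)]
    simp
  rw [← setIntegral_eq_integral_of_forall_compl_eq_zero hzero]
  refine setIntegral_closedBall_le hr fun x _ => ?_
  rw [abs_of_nonneg (by positivity)]
  gcongr
  exact hb x

/- Testing `‖∇u‖² ≤ -Δu` with `ζ²` for a cutoff `ζ` at scale `R`, the cross term is absorbed by
`2 ζ ⟪∇ζ, ∇u⟫ ≤ ζ² ‖∇u‖² / 2 + 2 ‖∇ζ‖²`. -/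
theorem exists_setIntegral_norm_gradient_sq_le (hn : 2 ≤ n) {u : E n → ℝ} (hu : ContDiff ℝ ∞ u)
    (h : ∀ᶠ x in cocompact (E n), ‖∇ u x‖ ^ 2 + Δ u x ≤ 0) :
    ∃ C : ℝ, ∀ R : ℝ, 1 ≤ R → ∫ x in closedBall 0 R, ‖∇ u x‖ ^ 2 ≤ C * R ^ (n - 2) := by
  set p : E n → ℝ := fun x => ‖∇ u x‖ ^ 2 + Δ u x
  have hpc : Continuous p :=
    ((continuous_gradient hu (by simp)).norm.pow 2).add (contDiff_laplacian hu).continuous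
  have hqi : Integrable fun x => max (p x) 0 := by
    refine (hpc.max continuous_const).integrable_of_hasCompactSupport ?_
    rw [hasCompactSupport_iff_eventuallyEq, coclosedCompact_eq_cocompact]
    exact h.mono fun x hx => max_eq_right hx
  obtain ⟨M, hM⟩ := exists_cutoff n
  refine ⟨2 * (∫ x, max (p x) 0) + 4 * (M ^ 2 * (2 ^ n * volume.real (ball (0 : E n) 1))),
    fun R hR => ?_⟩
  have hR0 : 0 < R := by linarith
  obtain ⟨ζ, hζ, hζ01, hsupp, hζ1, hgrad⟩ := hM R hR0
  have hζc : HasCompactSupport ζ :=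
    (isCompact_closedBall _ _).of_isClosed_subset (isClosed_tsupport ζ) hsupp
  have hζ2 : HasCompactSupport fun x => ζ x ^ 2 := hζc.comp_left (zero_pow two_ne_zero)
  have hpos : ∫ x, ζ x ^ 2 * p x ≤ ∫ x, max (p x) 0 := by
    refine integral_mono (((hζ.continuous.pow 2).mul hpc).integrable_of_hasCompactSupport
      hζ2.mul_right) hqi fun x => ?_
    calc ζ x ^ 2 * p x ≤ ζ x ^ 2 * max (p x) 0 := by gcongr; exact le_max_left _ _
      _ ≤ max (p x) 0 := mul_le_of_le_one_left (le_max_right _ _)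
        (pow_le_one₀ (hζ01 x).1 (hζ01 x).2)
  have hcut : ∫ x, ‖∇ ζ x‖ ^ 2
      ≤ M ^ 2 * (2 ^ n * volume.real (ball (0 : E n) 1)) * R ^ (n - 2) := by
    refine (integral_norm_gradient_sq_cutoff_le (by positivity) hsupp hgrad).trans_eq ?_
    obtain ⟨k, rfl⟩ := Nat.exists_eq_add_of_le hn
    rw [Nat.add_sub_cancel_left, div_pow, mul_pow, pow_add R]
    field_simp
  have hball : ∫ x in closedBall 0 R, ‖∇ u x‖ ^ 2 ≤ ∫ x, ζ x ^ 2 * ‖∇ u x‖ ^ 2 := by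
    rw [setIntegral_congr_fun (g := fun x => ζ x ^ 2 * ‖∇ u x‖ ^ 2) measurableSet_closedBall
      fun x hx => by simp [hζ1 hx]]
    exact setIntegral_le_integral (((hζ.continuous.pow 2).mul ((continuous_gradient hu
      (by simp)).norm.pow 2)).integrable_of_hasCompactSupport hζ2.mul_right)
      (Eventually.of_forall fun x => by positivity)
  have hscale : ∫ x, max (p x) 0 ≤ (∫ x, max (p x) 0) * R ^ (n - 2) :=
    le_mul_of_one_le_right (integral_nonneg fun x => le_max_right _ _) (one_le_pow₀ hR)
  linarith [integral_sq_mul_norm_gradient_sq_le hu hζ hζc]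

theorem exists_setIntegral_norm_gradient_le (hn : 2 ≤ n) {u : E n → ℝ} (hu : ContDiff ℝ ∞ u)
    (h : ∀ᶠ x in cocompact (E n), ‖∇ u x‖ ^ 2 + Δ u x ≤ 0) :
    ∃ C : ℝ, ∀ R : ℝ, 1 ≤ R → ∫ x in closedBall 0 R, ‖∇ u x‖ ≤ C * R ^ (n - 1) := by
  obtain ⟨C, hC⟩ := exists_setIntegral_norm_gradient_sq_le hn hu h
  refine ⟨C + volume.real (ball (0 : E n) 1), fun R hR => ?_⟩
  have hR0 : 0 < R := by linarith
  have hc := (continuous_gradient hu (by simp)).norm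
  have hsq : IntegrableOn (fun x => R * ‖∇ u x‖ ^ 2) (closedBall 0 R) :=
    (continuous_const.mul (hc.pow 2)).continuousOn.integrableOn_compact (isCompact_closedBall _ _)
  have hconst : IntegrableOn (fun _ : E n => R⁻¹) (closedBall 0 R) :=
    integrableOn_const measure_closedBall_lt_top.ne
  have hyoung (t : ℝ) : t ≤ R * t ^ 2 + R⁻¹ := by
    have : R * t ^ 2 + R⁻¹ - t = R * (t - (2 * R)⁻¹) ^ 2 + 3 / 4 * R⁻¹ := by field_simp; ring
    have : 0 ≤ R * (t - (2 * R)⁻¹) ^ 2 + 3 / 4 * R⁻¹ := by positivity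
    linarith
  obtain ⟨k, rfl⟩ := Nat.exists_eq_add_of_le hn
  specialize hC R hR
  rw [Nat.add_sub_cancel_left] at hC
  rw [show 2 + k - 1 = k + 1 by omega]
  calc ∫ x in closedBall 0 R, ‖∇ u x‖ ≤ ∫ x in closedBall 0 R, (R * ‖∇ u x‖ ^ 2 + R⁻¹) :=
        setIntegral_mono (hc.continuousOn.integrableOn_compact (isCompact_closedBall _ _))
          (hsq.add hconst) fun _ => hyoung _
    _ = R * (∫ x in closedBall 0 R, ‖∇ u x‖ ^ 2) + ∫ _ in closedBall (0 : E (2 + k)) R, R⁻¹ := by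
        rw [integral_add hsq hconst, integral_const_mul]
    _ ≤ R * (C * R ^ k) + R⁻¹ * (R ^ (2 + k) * volume.real (ball (0 : E (2 + k)) 1)) := by
        gcongr
        exact setIntegral_closedBall_le hR0.le fun _ _ => (abs_of_pos (inv_pos.2 hR0)).le
    _ = (C + volume.real (ball (0 : E (2 + k)) 1)) * R ^ (k + 1) := by
        rw [pow_add R 2]
        field_simp
        ring

theorem eqOn_radialLaplacian {ψ φ : ℝ → ℝ} {s : Set ℝ} (h : EqOn ψ φ s) (hs : IsOpen s) :
    EqOn (radialLaplacian n ψ) (radialLaplacian n φ) s := fun t ht => by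
  rw [radialLaplacian, radialLaplacian, h.deriv hs ht, (h.deriv hs).deriv hs ht]

theorem radialLaplacian_log {t : ℝ} (ht : t ≠ 0) :
    radialLaplacian n Real.log t = (2 * n - 4) * t⁻¹ := by
  rw [radialLaplacian, Real.deriv_log', deriv_inv]
  field_simp
  ring

theorem deriv_const_mul_zpow (c : ℝ) (z : ℤ) :
    deriv (fun t : ℝ => c * t ^ z) = fun t => c * z * t ^ (z - 1) := by
  ext t
  rw [deriv_const_mul_field, deriv_zpow, mul_assoc]

theorem radialLaplacian_const_mul_zpow (c : ℝ) (z : ℤ) {t : ℝ} (ht : t ≠ 0) :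
    radialLaplacian n (fun t => c * t ^ z) t
      = c * (4 * z * (z - 1) + 2 * n * z) * t ^ (z - 1) := by
  have hpow : t ^ (z - 1) = t * t ^ (z - 1 - 1) := by
    rw [mul_comm, ← zpow_add_one₀ ht, sub_add_cancel]
  simp only [radialLaplacian, deriv_const_mul_zpow, hpow]
  push_cast
  ring

theorem radialLaplacian_sub {ψ φ : ℝ → ℝ} (hψ : ContDiff ℝ ∞ ψ) (hφ : ContDiff ℝ ∞ φ) :
    radialLaplacian n (ψ - φ) = radialLaplacian n ψ - radialLaplacian n φ := by
  have hderiv {ψ φ : ℝ → ℝ} (hψ : ContDiff ℝ ∞ ψ) (hφ : ContDiff ℝ ∞ φ) :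
      deriv (ψ - φ) = deriv ψ - deriv φ := funext fun t =>
    deriv_sub (hψ.differentiable (by simp) t) (hφ.differentiable (by simp) t)
  ext t
  simp only [radialLaplacian, hderiv hψ hφ, hderiv (contDiff_deriv hψ) (contDiff_deriv hφ),
    Pi.sub_apply]
  ring

theorem iterate_radialLaplacian_sub (m : ℕ) {ψ φ : ℝ → ℝ} (hψ : ContDiff ℝ ∞ ψ)
    (hφ : ContDiff ℝ ∞ φ) :
    (radialLaplacian n)^[m] (ψ - φ) = (radialLaplacian n)^[m] ψ - (radialLaplacian n)^[m] φ := by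
  induction m generalizing ψ φ with
  | zero => rfl
  | succ m ih =>
    simp only [Function.iterate_succ_apply, radialLaplacian_sub hψ hφ,
      ih (contDiff_radialLaplacian n hψ) (contDiff_radialLaplacian n hφ)]

theorem radialLaplacian_comp_const_mul (ψ : ℝ → ℝ) (a : ℝ) :
    radialLaplacian n (fun t => ψ (a * t)) = fun t => a * radialLaplacian n ψ (a * t) := by
  have hderiv (φ : ℝ → ℝ) : deriv (fun t => φ (a * t)) = fun t => a * deriv φ (a * t) := by
    ext t
    simpa using deriv_comp_mul_left a φ t
  ext t
  simp only [radialLaplacian, hderiv, deriv_const_mul_field]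
  ring

theorem radialLaplacian_const_mul (a : ℝ) (ψ : ℝ → ℝ) :
    radialLaplacian n (fun t => a * ψ t) = fun t => a * radialLaplacian n ψ t := by
  ext t
  simp only [radialLaplacian, deriv_const_mul_field']
  ring

theorem iterate_radialLaplacian_const_mul (m : ℕ) (a : ℝ) (ψ : ℝ → ℝ) :
    (radialLaplacian n)^[m] (fun t => a * ψ t) = fun t => a * (radialLaplacian n)^[m] ψ t := by
  induction m generalizing ψ with
  | zero => rfl
  | succ m ih => simp only [Function.iterate_succ_apply, radialLaplacian_const_mul, ih]

theorem iterate_radialLaplacian_comp_const_mul (m : ℕ) (ψ : ℝ → ℝ) (a : ℝ) :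
    (radialLaplacian n)^[m] (fun t => ψ (a * t))
      = fun t => a ^ m * (radialLaplacian n)^[m] ψ (a * t) := by
  induction m generalizing ψ with
  | zero => simp
  | succ m ih =>
    simp only [Function.iterate_succ_apply, radialLaplacian_comp_const_mul,
      iterate_radialLaplacian_const_mul, ih, pow_succ', mul_assoc]

theorem iterate_radialLaplacian_add_const (m : ℕ) (ψ : ℝ → ℝ) (c : ℝ) :
    (radialLaplacian n)^[m + 1] (fun t => ψ t + c) = (radialLaplacian n)^[m + 1] ψ := by
  rw [Function.iterate_succ_apply, Function.iterate_succ_apply]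
  congr 1
  ext t
  simp [radialLaplacian]

theorem hasDerivAt_two_mul_pow_mul_deriv (hn : n ≠ 0) {ψ : ℝ → ℝ} (hψ : ContDiff ℝ ∞ ψ) (r : ℝ) :
    HasDerivAt (fun r => 2 * r ^ n * deriv ψ (r ^ 2))
      (r ^ (n - 1) * radialLaplacian n ψ (r ^ 2)) r := by
  have hcomp := ((contDiff_deriv hψ).differentiable (by simp) (r ^ 2)).hasDerivAt.comp r
    (hasDerivAt_pow 2 r)
  refine (((hasDerivAt_pow n r).const_mul 2).mul hcomp).congr_deriv ?_
  rw [radialLaplacian, ← pow_sub_one_mul hn r, Function.comp_apply]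
  push_cast
  ring

/- The divergence theorem for a radial function: `L` is the limiting flux through large spheres,
per unit of solid angle. -/
theorem integral_radialLaplacian (hn : n ≠ 0) {ψ : ℝ → ℝ} (hψ : ContDiff ℝ ∞ ψ)
    (hint : Integrable fun z : E n => radialLaplacian n ψ (‖z‖ ^ 2)) {L : ℝ}
    (hL : Tendsto (fun r => 2 * r ^ n * deriv ψ (r ^ 2)) atTop (𝓝 L)) :
    ∫ z : E n, radialLaplacian n ψ (‖z‖ ^ 2) = n * volume.real (ball (0 : E n) 1) * L := by
  have : Nonempty (Fin n) := ⟨⟨0, Nat.pos_of_ne_zero hn⟩⟩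
  rw [integrable_fun_norm_addHaar volume (f := fun r => radialLaplacian n ψ (r ^ 2)),
    finrank_euclideanSpace_fin] at hint
  rw [integral_fun_norm_addHaar volume (fun r => radialLaplacian n ψ (r ^ 2)),
    finrank_euclideanSpace_fin]
  simp only [smul_eq_mul, nsmul_eq_mul] at hint ⊢
  rw [integral_Ioi_of_hasDerivAt_of_tendsto
    (hasDerivAt_two_mul_pow_mul_deriv hn hψ 0).continuousAt.continuousWithinAt
    (fun r _ => hasDerivAt_two_mul_pow_mul_deriv hn hψ r) hint hL]
  simp [hn, mul_assoc]

/-- A smooth function on `ℝ` which agrees with the logarithm on `[1, ∞)`. It serves as the profile,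
in the variable `‖x‖²`, of a logarithmic kernel regularised at the pole. -/
def smoothLog (t : ℝ) : ℝ := Real.smoothTransition (2 * t - 1) * Real.log t

theorem smoothLog_eqOn_log : EqOn smoothLog Real.log (Ici 1) := fun t ht => by
  rw [mem_Ici] at ht
  rw [smoothLog, Real.smoothTransition.one_of_one_le (by linarith), one_mul]

theorem contDiff_smoothLog : ContDiff ℝ ∞ smoothLog := by
  rw [contDiff_iff_contDiffAt]
  intro t
  rcases eq_or_ne t 0 with rfl | ht
  · have hzero : smoothLog =ᶠ[𝓝 0] fun _ => 0 := by
      filter_upwards [Iio_mem_nhds (show (0 : ℝ) < 1 / 2 by norm_num)] with s hs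
      rw [mem_Iio] at hs
      rw [smoothLog, Real.smoothTransition.zero_of_nonpos (by linarith), zero_mul]
    exact contDiffAt_const.congr_of_eventuallyEq hzero
  · have htrans : ContDiff ℝ ∞ fun t : ℝ => Real.smoothTransition (2 * t - 1) :=
      Real.smoothTransition.contDiff.comp (by fun_prop)
    exact htrans.contDiffAt.mul (Real.contDiffAt_log.2 ht)

theorem deriv_smoothLog {t : ℝ} (ht : 1 < t) : deriv smoothLog t = t⁻¹ := by
  rw [(smoothLog_eqOn_log.mono Ioi_subset_Ici_self).deriv isOpen_Ioi ht, Real.deriv_log]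

theorem exists_abs_deriv_smoothLog_le : ∃ C, ∀ t, 0 < t → |deriv smoothLog t| ≤ C / t := by
  have hc : Continuous fun t => t * deriv smoothLog t :=
    continuous_id.mul (contDiff_deriv contDiff_smoothLog).continuous
  obtain ⟨C, hC⟩ := (isCompact_Icc (a := (0 : ℝ)) (b := 1)).exists_bound_of_continuousOn
    hc.continuousOn
  refine ⟨max C 1, fun t ht => ?_⟩
  rw [le_div_iff₀ ht, mul_comm, ← abs_of_pos ht, ← abs_mul, abs_of_pos ht]
  rcases le_or_gt t 1 with h | h
  · exact (hC t ⟨ht.le, h⟩).trans (le_max_left _ _)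
  · rw [deriv_smoothLog h, mul_inv_cancel₀ ht.ne', abs_one]
    exact le_max_right _ _

theorem radialLaplacian_smoothLog {t : ℝ} (ht : 1 < t) :
    radialLaplacian n smoothLog t = (2 * n - 4) * t⁻¹ := by
  rw [eqOn_radialLaplacian (smoothLog_eqOn_log.mono Ioi_subset_Ici_self) isOpen_Ioi ht,
    radialLaplacian_log (by linarith)]

theorem iterate_radialLaplacian_smoothLog (n j : ℕ) :
    EqOn ((radialLaplacian n)^[j + 1] smoothLog)
      (fun t => (2 * n - 4)
        * (∏ i ∈ Finset.range j, (4 * ((i : ℝ) + 1) * (i + 2) - 2 * n * (i + 1)))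
        * t ^ (-(j + 1 : ℤ))) (Ioi 1) := by
  induction j with
  | zero =>
    intro t ht
    simp [radialLaplacian_smoothLog ht]
  | succ j ih =>
    intro t ht
    have ht0 : t ≠ 0 := (one_pos.trans ht).ne'
    rw [Function.iterate_succ_apply', eqOn_radialLaplacian ih isOpen_Ioi ht,
      radialLaplacian_const_mul_zpow _ _ ht0, Finset.prod_range_succ, ← neg_add']
    push_cast
    ring

/-- The profile, in the variable `‖x‖²`, of the compactly supported smooth function on `ℝ²ᵐ`
obtained by applying `Δᵐ` to the regularised logarithm. Its dilations approximate a multiple of the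
Dirac mass, since `log ‖x‖` is a fundamental solution of `Δᵐ` up to a constant. -/
def bump (m : ℕ) : ℝ → ℝ := (radialLaplacian (2 * m))^[m] smoothLog

theorem contDiff_bump (m : ℕ) : ContDiff ℝ ∞ (bump m) :=
  contDiff_iterate_radialLaplacian _ _ contDiff_smoothLog

theorem bump_eq_zero {k : ℕ} {t : ℝ} (ht : 1 ≤ t) : bump (k + 2) t = 0 := by
  have hzero : Ioi (1 : ℝ) ⊆ {t | bump (k + 2) t = 0} := fun t ht => by
    rw [mem_ofPred_eq, bump, iterate_radialLaplacian_smoothLog _ _ ht, Finset.prod_range_succ]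
    push_cast
    ring
  have hclosed : IsClosed {t | bump (k + 2) t = 0} :=
    isClosed_eq (contDiff_bump _).continuous continuous_const
  exact hclosed.closure_subset_iff.2 hzero (by rwa [closure_Ioi])

theorem continuous_bump_norm_sq (m n : ℕ) : Continuous fun z : E n => bump m (‖z‖ ^ 2) :=
  (contDiff_bump m).continuous.comp (continuous_norm.pow 2)

theorem hasCompactSupport_bump_norm_sq (k n : ℕ) :
    HasCompactSupport fun z : E n => bump (k + 2) (‖z‖ ^ 2) := by
  refine .intro (isCompact_closedBall 0 1) fun z hz => bump_eq_zero (one_le_pow₀ ?_)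
  exact (not_le.1 (mem_closedBall_zero_iff.not.1 hz)).le

theorem prod_range_eq_neg_four_pow_mul_factorial_sq (k : ℕ) :
    ∏ i ∈ Finset.range k, (4 * ((i : ℝ) + 1) * (i + 2) - 2 * (2 * (k + 2) : ℕ) * (i + 1))
      = (-4) ^ k * (k.factorial : ℝ) ^ 2 := by
  have hterm : ∀ i ∈ Finset.range k,
      (4 * ((i : ℝ) + 1) * (i + 2) - 2 * (2 * (k + 2) : ℕ) * (i + 1))
        = -4 * (((i + 1 : ℕ) : ℝ) * ((k - 1 - i + 1 : ℕ) : ℝ)) := fun i hi => by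
    have hi := Finset.mem_range.1 hi
    rw [show k - 1 - i + 1 = k - i by omega, Nat.cast_sub hi.le]
    push_cast
    ring
  rw [Finset.prod_congr rfl hterm, Finset.prod_mul_distrib, Finset.prod_mul_distrib,
    Finset.prod_range_reflect (fun i => ((i + 1 : ℕ) : ℝ)), ← Nat.cast_prod,
    Finset.prod_range_add_one_eq_factorial, Finset.prod_const, Finset.card_range, sq]

theorem tendsto_two_mul_pow_mul_deriv_iterate_radialLaplacian_smoothLog (k : ℕ) :
    Tendsto (fun r : ℝ => 2 * r ^ (2 * (k + 2)) *
        deriv ((radialLaplacian (2 * (k + 2)))^[k + 1] smoothLog) (r ^ 2)) atTop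
      (𝓝 (-8 * (-4) ^ k * ((k + 1).factorial : ℝ) ^ 2)) := by
  refine tendsto_const_nhds.congr' ?_
  filter_upwards [eventually_gt_atTop 1] with r hr
  have hr2 : 1 < r ^ 2 := one_lt_pow₀ hr two_ne_zero
  have hpow : r ^ (2 * (k + 2)) * (r ^ 2) ^ (-(k + 1 : ℤ) - 1) = 1 := by
    rw [show -(k + 1 : ℤ) - 1 = -((k + 2 : ℕ) : ℤ) by push_cast; ring, zpow_neg, zpow_natCast,
      ← pow_mul]
    exact mul_inv_cancel₀ (by positivity)
  rw [(iterate_radialLaplacian_smoothLog _ k).deriv isOpen_Ioi hr2, deriv_const_mul_zpow,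
    prod_range_eq_neg_four_pow_mul_factorial_sq, Nat.factorial_succ]
  push_cast
  linear_combination 8 * (k + 1) ^ 2 * (-4) ^ k * (k.factorial : ℝ) ^ 2 * hpow

theorem volume_real_ball_of_dim_even (m : ℕ) :
    volume.real (ball (0 : E (2 * (m + 1))) 1) = Real.pi ^ (m + 1) / (m + 1).factorial := by
  have : Nonempty (Fin (2 * (m + 1))) := ⟨⟨0, by omega⟩⟩
  rw [Measure.real, InnerProductSpace.volume_ball_of_dim_even finrank_euclideanSpace_fin,
    ENNReal.ofReal_one, one_pow, one_mul, ENNReal.toReal_ofReal (by positivity)]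

theorem sphereVolume_two_mul (m : ℕ) : sphereVolume (2 * m)
    = (2 * m + 1) * (Real.pi ^ m * 2 ^ (m + 1) / (2 * m + 1).doubleFactorial) := by
  rw [sphereVolume, Measure.toSphere_real_apply_univ, Measure.real,
    InnerProductSpace.volume_ball_of_dim_odd finrank_euclideanSpace_fin, finrank_euclideanSpace_fin,
    ENNReal.ofReal_one, one_pow, one_mul, ENNReal.toReal_ofReal (by positivity)]
  push_cast
  rfl

/-- The critical total Q-curvature `(n-1)! |𝕊ⁿ| / 2`, half of the one of the round sphere. -/
def critConst (n : ℕ) : ℝ := (n - 1).factorial * sphereVolume n / 2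

theorem critConst_pos (n : ℕ) : 0 < critConst n := by
  have hball : 0 < volume.real (ball (0 : E (n + 1)) 1) :=
    ENNReal.toReal_pos (measure_ball_pos _ _ one_pos).ne' measure_ball_lt_top.ne
  rw [critConst, sphereVolume, Measure.toSphere_real_apply_univ, finrank_euclideanSpace_fin]
  positivity

theorem critConst_eq_factorial_mul_pi_pow (m : ℕ) :
    critConst (2 * (m + 1)) = 2 ^ (2 * m + 1) * m.factorial * Real.pi ^ (m + 1) := by
  have hfact : ((2 * (m + 1) - 1).factorial : ℝ)
      = (2 * m + 1).doubleFactorial * (2 ^ m * m.factorial) := by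
    exact_mod_cast Nat.doubleFactorial_two_mul m ▸ Nat.factorial_eq_mul_doubleFactorial (2 * m)
  have hodd : ((2 * (m + 1) + 1).doubleFactorial : ℝ)
      = (2 * (m + 1) + 1) * (2 * m + 1).doubleFactorial := by
    exact_mod_cast Nat.doubleFactorial_add_two (2 * m + 1)
  rw [critConst, sphereVolume_two_mul, hfact, hodd]
  push_cast
  field_simp
  ring

theorem integral_bump (k : ℕ) : ∫ z : E (2 * (k + 2)), bump (k + 2) (‖z‖ ^ 2)
    = -2 * (-1) ^ k * critConst (2 * (k + 2)) := by
  have hbump : bump (k + 2) = radialLaplacian (2 * (k + 2))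
      ((radialLaplacian (2 * (k + 2)))^[k + 1] smoothLog) := Function.iterate_succ_apply' _ _ _
  have hpow : (2 : ℝ) ^ (2 * (k + 1) + 1) = 8 * 4 ^ k := by
    rw [pow_succ, pow_mul, pow_succ]
    norm_num
    ring
  have hint := (continuous_bump_norm_sq (k + 2) (2 * (k + 2))).integrable_of_hasCompactSupport
    (μ := volume) (hasCompactSupport_bump_norm_sq k _)
  rw [hbump] at hint ⊢
  rw [integral_radialLaplacian (by omega)
    (contDiff_iterate_radialLaplacian _ _ contDiff_smoothLog) hint
    (tendsto_two_mul_pow_mul_deriv_iterate_radialLaplacian_smoothLog k),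
    volume_real_ball_of_dim_even, critConst_eq_factorial_mul_pi_pow, Nat.factorial_succ (k + 1),
    neg_pow (4 : ℝ) k, hpow]
  push_cast
  field_simp
  ring

theorem integrableOn_inv_norm_pow {p : ℕ} (hp : p < n) :
    IntegrableOn (fun z : E n => (‖z‖ ^ p)⁻¹) (ball 0 1) := by
  have : Nonempty (Fin n) := ⟨⟨0, by omega⟩⟩
  rw [integrableOn_fun_norm_addHaar volume (f := fun r : ℝ => (r ^ p)⁻¹)]
  have hpow : IntegrableOn (fun y : ℝ => y ^ (n - 1 - p)) (Ioo 0 1) :=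
    ((continuous_pow _).continuousOn.integrableOn_compact isCompact_Icc).mono_set
      Ioo_subset_Icc_self
  refine hpow.congr_fun (fun y hy => ?_) measurableSet_Ioo
  simp only [finrank_euclideanSpace_fin, smul_eq_mul]
  rw [pow_sub₀ y hy.1.ne' (by omega)]

theorem abs_div_norm_pow_le (p : ℕ) {f : E n → ℝ} {x : E n} {M : ℝ}
    (hM : ∀ y ∈ ball x 1, |f y| ≤ M) (y : E n) :
    |f y| / ‖x - y‖ ^ p
      ≤ M * (ball (0 : E n) 1).indicator (fun z => (‖z‖ ^ p)⁻¹) (x - y) + |f y| := by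
  by_cases hy : x - y ∈ ball (0 : E n) 1
  · have hfM : |f y| ≤ M := hM y (by rwa [mem_ball', dist_eq_norm, ← mem_ball_zero_iff])
    rw [indicator_of_mem hy, div_eq_mul_inv]
    exact le_add_of_le_of_nonneg (mul_le_mul_of_nonneg_right hfM (by positivity)) (abs_nonneg _)
  · rw [indicator_of_notMem hy, mul_zero, zero_add]
    rw [mem_ball_zero_iff, not_lt] at hy
    exact div_le_self (abs_nonneg _) (one_le_pow₀ hy)

section RieszPotential

variable {p : ℕ} {f : E n → ℝ}

theorem integrable_div_norm_pow (hp : p < n) (hf : Integrable f) {x : E n} {M : ℝ}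
    (hM : ∀ y ∈ ball x 1, |f y| ≤ M) : Integrable fun y => |f y| / ‖x - y‖ ^ p := by
  have hball := ((integrable_indicator_iff measurableSet_ball).2
    (integrableOn_inv_norm_pow hp)).comp_sub_left x
  have hmeas : Measurable fun y : E n => (‖x - y‖ ^ p)⁻¹ := by fun_prop
  refine ((hball.const_mul M).add hf.abs).mono'
    (hf.abs.aestronglyMeasurable.mul hmeas.aestronglyMeasurable) (ae_of_all _ fun y => ?_)
  rw [Real.norm_of_nonneg (by positivity)]
  exact abs_div_norm_pow_le p hM y

theorem integral_div_norm_pow_le (hp : p < n) (hf : Integrable f) {x : E n} {M : ℝ}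
    (hM : ∀ y ∈ ball x 1, |f y| ≤ M) :
    ∫ y, |f y| / ‖x - y‖ ^ p ≤ M * (∫ z in ball (0 : E n) 1, (‖z‖ ^ p)⁻¹) + ∫ y, |f y| := by
  have hball := ((integrable_indicator_iff measurableSet_ball).2
    (integrableOn_inv_norm_pow hp)).comp_sub_left x
  refine (integral_mono (integrable_div_norm_pow hp hf hM) ((hball.const_mul M).add hf.abs)
    (abs_div_norm_pow_le p hM)).trans_eq ?_
  rw [integral_add' (hball.const_mul M) hf.abs, integral_const_mul,
    integral_sub_left_eq_self (fun y => (ball (0 : E n) 1).indicator (fun z => (‖z‖ ^ p)⁻¹) y),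
    integral_indicator measurableSet_ball]

theorem exists_integral_div_norm_pow_le (hp : p < n) (hf : Integrable f) (hc : Continuous f)
    (r : ℝ) : ∃ A, ∀ x ∈ closedBall (0 : E n) r,
      Integrable (fun y => |f y| / ‖x - y‖ ^ p) ∧ ∫ y, |f y| / ‖x - y‖ ^ p ≤ A := by
  obtain ⟨M, hM⟩ := (isCompact_closedBall (0 : E n) (1 + r)).exists_bound_of_continuousOn
    hc.continuousOn
  refine ⟨M * (∫ z in ball (0 : E n) 1, (‖z‖ ^ p)⁻¹) + ∫ y, |f y|, fun x hx => ?_⟩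
  have hMx : ∀ y ∈ ball x 1, |f y| ≤ M := fun y hy =>
    hM y (ball_subset_closedBall.trans (closedBall_subset_closedBall' (by gcongr; exact hx)) hy)
  exact ⟨integrable_div_norm_pow hp hf hMx, integral_div_norm_pow_le hp hf hMx⟩

theorem integrable_div_norm (hn : 1 < n) (hf : Integrable f) (hc : Continuous f) (x : E n) :
    Integrable fun y => |f y| / ‖x - y‖ := by
  obtain ⟨A, hA⟩ := exists_integral_div_norm_pow_le hn hf hc ‖x‖
  simpa only [pow_one] using (hA x (by simp)).1

theorem exists_setLIntegral_inv_norm_sub_pow_le (hp : p < n) {B : Set (E n)}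
    (hB : MeasurableSet B) (hB' : volume B ≠ ⊤) : ∃ A : ℝ, 0 ≤ A ∧
      ∀ z, ∫⁻ x in B, ENNReal.ofReal ((‖x - z‖ ^ p)⁻¹) ≤ ENNReal.ofReal A := by
  have hint : Integrable (B.indicator fun _ => (1 : ℝ)) :=
    (integrable_indicator_iff hB).2 (integrableOn_const hB')
  have hle : ∀ z : E n, ∀ y ∈ ball z 1, |B.indicator (fun _ => (1 : ℝ)) y| ≤ 1 := fun z y _ => by
    by_cases hy : y ∈ B <;> simp [hy]
  refine ⟨1 * (∫ z in ball (0 : E n) 1, (‖z‖ ^ p)⁻¹) + ∫ y, |B.indicator (fun _ => (1 : ℝ)) y|,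
    ?_, fun z => ?_⟩
  · have := setIntegral_nonneg (μ := volume) (s := ball (0 : E n) 1) measurableSet_ball
      fun z _ => inv_nonneg.2 (pow_nonneg (norm_nonneg z) p)
    have := integral_nonneg (μ := volume) (f := fun y => |B.indicator (fun _ => (1 : ℝ)) y|)
      fun y => abs_nonneg _
    positivity
  · have heq : ∫⁻ x in B, ENNReal.ofReal ((‖x - z‖ ^ p)⁻¹)
        = ∫⁻ x, ENNReal.ofReal (|B.indicator (fun _ => (1 : ℝ)) x| / ‖z - x‖ ^ p) := by
      rw [← lintegral_indicator hB]
      refine lintegral_congr fun x => ?_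
      by_cases hx : x ∈ B <;> simp [hx, norm_sub_rev]
    rw [heq, ← ofReal_integral_eq_lintegral_ofReal (integrable_div_norm_pow hp hint (hle z))
      (ae_of_all _ fun x => by positivity)]
    exact ENNReal.ofReal_le_ofReal (integral_div_norm_pow_le hp hint (hle z))

end RieszPotential

section Dilation

variable {b w : E n → ℝ}

theorem integral_pow_mul_comp_smul_sub_mul (b w : E n → ℝ) (x : E n) {N : ℝ} (hN : 0 < N) :
    ∫ y, N ^ n * b (N • (y - x)) * w y = ∫ z, b z * w (x + N⁻¹ • z) := by
  have hscale := Measure.integral_comp_smul volume (fun z => b z * w (x + N⁻¹ • z)) N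
  rw [finrank_euclideanSpace_fin, abs_of_pos (by positivity), smul_eq_mul,
    eq_inv_mul_iff_mul_eq₀ (by positivity)] at hscale
  rw [← hscale, ← integral_sub_right_eq_self (fun z => b (N • z) * w (x + N⁻¹ • N • z)) x,
    ← integral_const_mul]
  simp only [inv_smul_smul₀ hN.ne', add_sub_cancel, mul_assoc]

theorem tendsto_integral_pow_mul_comp_smul_sub_mul (hb : Continuous b) (hbc : HasCompactSupport b)
    (hw : Continuous w) (x : E n) :
    Tendsto (fun N : ℝ => ∫ y, N ^ n * b (N • (y - x)) * w y) atTop (𝓝 ((∫ z, b z) * w x)) := by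
  obtain ⟨r, hr⟩ := hbc.isCompact.isBounded.subset_closedBall 0
  obtain ⟨M, hM⟩ := (isCompact_closedBall x r).exists_bound_of_continuousOn hw.continuousOn
  rw [← integral_mul_const]
  refine (tendsto_integral_filter_of_dominated_convergence (fun z => ‖b z‖ * M) ?_ ?_
    ((hb.integrable_of_hasCompactSupport hbc).norm.mul_const M) (ae_of_all _ fun z => ?_)).congr'
    ((eventually_gt_atTop 0).mono fun N hN => (integral_pow_mul_comp_smul_sub_mul b w x hN).symm)
  · exact Eventually.of_forall fun N =>
      (hb.mul (hw.comp (by fun_prop))).aestronglyMeasurable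
  · filter_upwards [eventually_ge_atTop 1] with N hN
    refine ae_of_all _ fun z => ?_
    rw [norm_mul]
    by_cases hz : z ∈ tsupport b
    · gcongr
      refine hM _ ?_
      rw [mem_closedBall, dist_eq_norm, add_sub_cancel_left, norm_smul, norm_inv,
        Real.norm_of_nonneg (by linarith)]
      exact (mul_le_of_le_one_left (norm_nonneg _) (inv_le_one_of_one_le₀ hN)).trans
        (mem_closedBall_zero_iff.1 (hr hz))
    · simp [image_eq_zero_of_notMem_tsupport hz]
  · have hlim : Tendsto (fun N : ℝ => x + N⁻¹ • z) atTop (𝓝 (x + (0 : ℝ) • z)) :=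
      (tendsto_inv_atTop_zero.smul_const z).const_add x
    rw [zero_smul, add_zero] at hlim
    exact ((hw.tendsto x).comp hlim).const_mul _

theorem norm_pow_mul_comp_smul_sub_mul_le {B r : ℝ} (hB : ∀ z, ‖b z‖ ≤ B)
    (hsupp : tsupport b ⊆ closedBall 0 r) {x : E n} {s : ℝ} (hs : 0 < s) (hx : ‖x‖ ≤ s⁻¹)
    (y : E n) :
    ‖s ^ n * b (s • (y - x)) * w y‖
      ≤ (closedBall (0 : E n) ((r + 1) * s⁻¹)).indicator (fun y => s ^ n * B * |w y|) y := by
  by_cases hy : y ∈ closedBall (0 : E n) ((r + 1) * s⁻¹)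
  · rw [indicator_of_mem hy, norm_mul, norm_mul, norm_pow, Real.norm_of_nonneg hs.le,
      Real.norm_eq_abs (w y)]
    gcongr
    exact hB _
  · have hmem : s • (y - x) ∉ tsupport b := fun hmem => hy <| by
      have hyx := mem_closedBall_zero_iff.1 (hsupp hmem)
      rw [norm_smul, Real.norm_of_nonneg hs.le, mul_comm, ← le_div_iff₀ hs, div_eq_mul_inv] at hyx
      rw [mem_closedBall_zero_iff]
      calc ‖y‖ = ‖(y - x) + x‖ := by rw [sub_add_cancel]
        _ ≤ ‖y - x‖ + ‖x‖ := norm_add_le _ _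
        _ ≤ (r + 1) * s⁻¹ := by linarith
    rw [image_eq_zero_of_notMem_tsupport hmem, mul_zero, zero_mul, norm_zero]
    exact indicator_nonneg (fun y _ => by have := (norm_nonneg _).trans (hB 0); positivity) y

theorem tendsto_integral_pow_mul_comp_smul_sub_mul_zero (hn : n ≠ 0) (hb : Continuous b)
    (hbc : HasCompactSupport b) (hw : Continuous w) {C : ℝ}
    (hC : ∀ R : ℝ, 1 ≤ R → ∫ y in closedBall 0 R, |w y| ≤ C * R ^ (n - 1)) (x : E n) :
    Tendsto (fun s : ℝ => ∫ y, s ^ n * b (s • (y - x)) * w y) (𝓝[>] 0) (𝓝 0) := by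
  obtain ⟨B, hB⟩ := hb.bounded_above_of_compact_support hbc
  have hB0 : 0 ≤ B := (norm_nonneg _).trans (hB 0)
  obtain ⟨r, hr0, hr⟩ := hbc.isCompact.isBounded.subset_closedBall_lt 0 0
  have hbound : ∀ᶠ s : ℝ in 𝓝[>] 0,
      ‖∫ y, s ^ n * b (s • (y - x)) * w y‖ ≤ B * C * (r + 1) ^ (n - 1) * s := by
    filter_upwards [self_mem_nhdsWithin, tendsto_inv_nhdsGT_zero.eventually_ge_atTop 1,
      tendsto_inv_nhdsGT_zero.eventually_ge_atTop ‖x‖] with s hs hs1 hx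
    rw [mem_Ioi] at hs
    have hi : IntegrableOn (fun y => |w y|) (closedBall (0 : E n) ((r + 1) * s⁻¹)) :=
      hw.abs.continuousOn.integrableOn_compact (isCompact_closedBall _ _)
    refine (norm_integral_le_of_norm_le ((integrable_indicator_iff
      measurableSet_closedBall).2 (hi.const_mul (s ^ n * B)))
      (ae_of_all _ (norm_pow_mul_comp_smul_sub_mul_le hB hr hs hx))).trans ?_
    rw [integral_indicator measurableSet_closedBall, integral_const_mul]
    calc s ^ n * B * ∫ y in closedBall (0 : E n) ((r + 1) * s⁻¹), |w y|
        ≤ s ^ n * B * (C * ((r + 1) * s⁻¹) ^ (n - 1)) := by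
          gcongr
          exact hC _ (one_le_mul_of_one_le_of_one_le (by linarith) hs1)
      _ = B * C * (r + 1) ^ (n - 1) * s := by
          rw [mul_pow, inv_pow, ← pow_sub_one_mul hn s]
          field_simp
  refine squeeze_zero_norm' hbound (tendsto_nhdsWithin_of_tendsto_nhds ?_)
  simpa using (continuous_const_mul (B * C * (r + 1) ^ (n - 1))).tendsto (0 : ℝ)

end Dilation

/-- The profile, in the variable `t = ‖x‖²`, of a smooth compactly supported truncation of the
logarithmic kernel `log ‖x‖²`, regularised at the scale `N⁻¹` and cut off at the scale `N`. -/
def logKernel (N t : ℝ) : ℝ :=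
  smoothLog (N ^ 2 * t) + -(4 * Real.log N) - smoothLog (N⁻¹ ^ 2 * t)

theorem contDiff_smoothLog_const_mul (a : ℝ) : ContDiff ℝ ∞ fun t => smoothLog (a * t) :=
  contDiff_smoothLog.comp (contDiff_const.mul contDiff_id)

theorem contDiff_logKernel (N : ℝ) : ContDiff ℝ ∞ (logKernel N) :=
  ((contDiff_smoothLog_const_mul _).add contDiff_const).sub (contDiff_smoothLog_const_mul _)

theorem logKernel_eq_zero {N t : ℝ} (hN : 1 ≤ N) (ht : N ^ 2 ≤ t) : logKernel N t = 0 := by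
  have : N ≠ 0 := by positivity
  have hN2 : 1 ≤ N ^ 2 := one_le_pow₀ hN
  have ht0 : t ≠ 0 := by linarith
  have hlarge : 1 ≤ N ^ 2 * t := by nlinarith
  have hsmall : 1 ≤ N⁻¹ ^ 2 * t := by
    rwa [inv_pow, le_inv_mul_iff₀ (by linarith), mul_one]
  rw [logKernel, smoothLog_eqOn_log hlarge, smoothLog_eqOn_log hsmall,
    Real.log_mul (by positivity) ht0, Real.log_mul (by positivity) ht0, Real.log_pow,
    Real.log_pow, Real.log_inv]
  push_cast
  ring

theorem hasCompactSupport_logKernel {N : ℝ} (hN : 1 ≤ N) (x : E n) :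
    HasCompactSupport fun y => logKernel N (‖y - x‖ ^ 2) := by
  refine .intro (isCompact_closedBall x N) fun y hy => logKernel_eq_zero hN ?_
  rw [mem_closedBall, dist_eq_norm, not_le] at hy
  gcongr

theorem iterate_laplacian_logKernel {m : ℕ} (hn : n = 2 * (m + 1)) (N : ℝ) (x : E n) :
    Δ^[m + 1] (fun y => logKernel N (‖y - x‖ ^ 2)) = fun y =>
      N ^ n * bump (m + 1) (‖N • (y - x)‖ ^ 2) - N⁻¹ ^ n * bump (m + 1) (‖N⁻¹ • (y - x)‖ ^ 2) := by
  have hkernel : logKernel N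
      = (fun t => smoothLog (N ^ 2 * t) + -(4 * Real.log N)) - fun t => smoothLog (N⁻¹ ^ 2 * t) :=
    rfl
  rw [iterate_laplacian_radial _ (contDiff_logKernel N), hkernel, iterate_radialLaplacian_sub _
    ((contDiff_smoothLog_const_mul _).add contDiff_const) (contDiff_smoothLog_const_mul _),
    iterate_radialLaplacian_add_const, iterate_radialLaplacian_comp_const_mul,
    iterate_radialLaplacian_comp_const_mul]
  subst hn
  simp only [Pi.sub_apply, bump, norm_smul, mul_pow, Real.norm_eq_abs, sq_abs, pow_mul]

theorem deriv_logKernel (N t : ℝ) : deriv (logKernel N) t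
    = N ^ 2 * deriv smoothLog (N ^ 2 * t) - N⁻¹ ^ 2 * deriv smoothLog (N⁻¹ ^ 2 * t) := by
  have hdiff (a : ℝ) : DifferentiableAt ℝ (fun t => smoothLog (a * t)) t :=
    (contDiff_smoothLog_const_mul a).differentiable (by simp) t
  have hderiv (a : ℝ) : deriv (fun t => smoothLog (a * t)) t = a * deriv smoothLog (a * t) := by
    simpa using deriv_comp_mul_left a smoothLog t
  unfold logKernel
  rw [deriv_fun_sub ((hdiff _).add_const _) (hdiff _), deriv_add_const, hderiv, hderiv]

theorem exists_abs_deriv_logKernel_le :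
    ∃ C, ∀ N t : ℝ, 0 < N → 0 < t → |deriv (logKernel N) t| ≤ C / t := by
  obtain ⟨C, hC⟩ := exists_abs_deriv_smoothLog_le
  refine ⟨C + C, fun N t hN ht => ?_⟩
  have hscale {a : ℝ} (ha : 0 < a) : |a * deriv smoothLog (a * t)| ≤ C / t := by
    rw [abs_mul, abs_of_pos ha]
    refine (mul_le_mul_of_nonneg_left (hC (a * t) (by positivity)) ha.le).trans_eq ?_
    field_simp
  rw [deriv_logKernel, add_div]
  exact (abs_sub _ _).trans (add_le_add (hscale (by positivity)) (hscale (by positivity)))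

theorem tendsto_deriv_logKernel {t : ℝ} (ht : 0 < t) :
    Tendsto (fun N => deriv (logKernel N) t) atTop (𝓝 t⁻¹) := by
  have hnear : Tendsto (fun N : ℝ => N ^ 2 * deriv smoothLog (N ^ 2 * t)) atTop (𝓝 t⁻¹) := by
    refine tendsto_const_nhds.congr' ?_
    filter_upwards [eventually_gt_atTop 0,
      (tendsto_pow_atTop two_ne_zero).eventually_gt_atTop t⁻¹] with N hN0 hN
    rw [deriv_smoothLog (by rwa [← inv_lt_iff_one_lt_mul₀ ht]), mul_inv,
      mul_inv_cancel_left₀ (by positivity)]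
  have hsq : Tendsto (fun N : ℝ => N⁻¹ ^ 2) atTop (𝓝 0) := by
    simpa using (tendsto_inv_atTop_zero (𝕜 := ℝ)).pow 2
  have hfar : Tendsto (fun N : ℝ => N⁻¹ ^ 2 * deriv smoothLog (N⁻¹ ^ 2 * t)) atTop
      (𝓝 (0 * deriv smoothLog (0 * t))) :=
    hsq.mul (((contDiff_deriv contDiff_smoothLog).continuous.tendsto _).comp (hsq.mul_const t))
  simpa [deriv_logKernel] using hnear.sub hfar

theorem abs_coord_le_norm (z : E n) (i : Fin n) : |z i| ≤ ‖z‖ :=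
  PiLp.norm_apply_le z i

theorem tendsto_integral_deriv_logKernel_mul (hn : 1 < n) {F : E n → ℝ} (hF : Integrable F)
    (hc : Continuous F) (i : Fin n) (x : E n) :
    Tendsto (fun N : ℝ => ∫ y, 2 * (y - x) i * deriv (logKernel N) (‖y - x‖ ^ 2) * F y) atTop
      (𝓝 (∫ y, 2 * (y - x) i * (‖y - x‖ ^ 2)⁻¹ * F y)) := by
  obtain ⟨C, hC⟩ := exists_abs_deriv_logKernel_le
  have : Nonempty (Fin n) := ⟨i⟩
  have hcoord : Continuous fun y : E n => (y - x) i := by fun_prop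
  refine tendsto_integral_filter_of_dominated_convergence
    (fun y => 2 * C * (|F y| / ‖x - y‖)) (Eventually.of_forall fun N => ?_) ?_
    ((integrable_div_norm hn hF hc x).const_mul _) ?_
  · have hderiv : Continuous fun y => deriv (logKernel N) (‖y - x‖ ^ 2) :=
      (contDiff_deriv (contDiff_logKernel N)).continuous.comp (by fun_prop)
    exact (((hcoord.const_mul 2).mul hderiv).mul hc).aestronglyMeasurable
  · filter_upwards [eventually_gt_atTop 0] with N hN
    refine ae_of_all _ fun y => ?_
    rcases eq_or_ne y x with rfl | hy
    · simp
    · have hy0 : 0 < ‖y - x‖ := norm_pos_iff.2 (sub_ne_zero.2 hy)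
      rw [norm_mul, norm_mul, norm_mul, Real.norm_two, Real.norm_eq_abs, Real.norm_eq_abs,
        Real.norm_eq_abs, norm_sub_rev x y]
      calc 2 * |(y - x) i| * |deriv (logKernel N) (‖y - x‖ ^ 2)| * |F y|
          ≤ 2 * ‖y - x‖ * (C / ‖y - x‖ ^ 2) * |F y| := by
            gcongr
            · exact abs_coord_le_norm _ _
            · exact hC N _ hN (by positivity)
        _ = 2 * C * (|F y| / ‖y - x‖) := by field_simp
  · filter_upwards [Measure.ae_ne volume x] with y hy
    have hy0 : 0 < ‖y - x‖ := norm_pos_iff.2 (sub_ne_zero.2 hy)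
    exact ((tendsto_deriv_logKernel (by positivity)).const_mul _).mul_const _

theorem integrable_bump_mul (k : ℕ) {w : E n → ℝ} (hw : Continuous w) (x : E n) {s : ℝ}
    (hs : s ≠ 0) : Integrable fun y => s ^ n * bump (k + 2) (‖s • (y - x)‖ ^ 2) * w y := by
  have hc : HasCompactSupport fun y : E n => bump (k + 2) (‖s • (y - x)‖ ^ 2) :=
    (hasCompactSupport_bump_norm_sq k n).comp_homeomorph
      ((Homeomorph.subRight x).trans (Homeomorph.smulOfNeZero s hs))
  have hcont : Continuous fun y : E n => bump (k + 2) (‖s • (y - x)‖ ^ 2) :=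
    (continuous_bump_norm_sq (k + 2) n).comp (by fun_prop)
  exact ((continuous_const.mul hcont).mul hw).integrable_of_hasCompactSupport hc.mul_left.mul_right

theorem integral_deriv_logKernel_mul_iterate_laplacian {k : ℕ} (hn : n = 2 * (k + 2))
    {u : E n → ℝ} (hu : ContDiff ℝ ∞ u) (i : Fin n) (x : E n) {N : ℝ} (hN : 1 ≤ N) :
    ∫ y, 2 * (y - x) i * deriv (logKernel N) (‖y - x‖ ^ 2) * (Δ^[k + 2] u) y
      = (∫ y, N⁻¹ ^ n * bump (k + 2) (‖N⁻¹ • (y - x)‖ ^ 2) * partialDeriv i u y)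
        - ∫ y, N ^ n * bump (k + 2) (‖N • (y - x)‖ ^ 2) * partialDeriv i u y := by
  have hN0 : N ≠ 0 := by positivity
  have hk := contDiff_radial (contDiff_logKernel N) x
  have hkc := hasCompactSupport_logKernel hN x
  have hw := (contDiff_partialDeriv i hu).continuous
  have hparts := integral_mul_partialDeriv i hk hkc (contDiff_iterate_laplacian (k + 2) hu)
  simp only [partialDeriv_radial i ((contDiff_logKernel N).differentiable (by simp)),
    ← iterate_laplacian_partialDeriv _ i hu] at hparts
  rw [integral_mul_iterate_laplacian _ hk hkc (contDiff_partialDeriv i hu),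
    iterate_laplacian_logKernel hn] at hparts
  simp only [sub_mul] at hparts
  rw [integral_sub (integrable_bump_mul k hw x hN0)
    (integrable_bump_mul k hw x (inv_ne_zero hN0))] at hparts
  linarith

/- Integrate `Δᵐ u`, `n = 2m`, against the derivative of the regularised logarithm and let the two
scales `N⁻¹` and `N` separate: the bump of width `N⁻¹` recovers the gradient, the one of width `N`
averages it out by the growth hypothesis. -/
theorem critConst_mul_partialDeriv {k : ℕ} (hn : n = 2 * (k + 2)) {u : E n → ℝ}
    (hu : ContDiff ℝ ∞ u) (hF : Integrable (Δ^[k + 2] u)) {C : ℝ}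
    (hC : ∀ R : ℝ, 1 ≤ R → ∫ y in closedBall 0 R, ‖∇ u y‖ ≤ C * R ^ (n - 1))
    (i : Fin n) (x : E n) :
    critConst n * partialDeriv i u x
      = ∫ y, (y - x) i * (‖y - x‖ ^ 2)⁻¹ * ((-1) ^ k * (Δ^[k + 2] u) y) := by
  have hw := (contDiff_partialDeriv i hu).continuous
  have hC' : ∀ R : ℝ, 1 ≤ R → ∫ y in closedBall 0 R, |partialDeriv i u y| ≤ C * R ^ (n - 1) :=
    fun R hR => (setIntegral_mono
      (hw.abs.continuousOn.integrableOn_compact (isCompact_closedBall _ _))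
      ((continuous_gradient hu (by simp)).norm.continuousOn.integrableOn_compact
        (isCompact_closedBall _ _))
      fun y => by simpa only [gradient_apply] using abs_coord_le_norm (∇ u y) i).trans (hC R hR)
  have hbump := continuous_bump_norm_sq (k + 2) n
  have hbumpc := hasCompactSupport_bump_norm_sq k n
  have hnear := tendsto_integral_pow_mul_comp_smul_sub_mul hbump hbumpc hw x
  have hfar := (tendsto_integral_pow_mul_comp_smul_sub_mul_zero (by omega) hbump hbumpc hw hC'
    x).comp tendsto_inv_atTop_nhdsGT_zero
  have hlimit := tendsto_nhds_unique ((hfar.sub hnear).congr' <|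
    (eventually_ge_atTop 1).mono fun N hN =>
      (integral_deriv_logKernel_mul_iterate_laplacian hn hu i x hN).symm)
    (tendsto_integral_deriv_logKernel_mul (by omega) hF
      (contDiff_iterate_laplacian _ hu).continuous i x)
  have htotal : ∫ z : E n, bump (k + 2) (‖z‖ ^ 2) = -2 * (-1) ^ k * critConst n := by
    subst hn
    exact integral_bump k
  have hpull : ∫ y, 2 * (y - x) i * (‖y - x‖ ^ 2)⁻¹ * (Δ^[k + 2] u) y
      = 2 * (-1) ^ k * ∫ y, (y - x) i * (‖y - x‖ ^ 2)⁻¹ * ((-1) ^ k * (Δ^[k + 2] u) y) := by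
    rw [← integral_const_mul]
    congr 1 with y
    linear_combination (-2 * (y - x) i * (‖y - x‖ ^ 2)⁻¹ * (Δ^[k + 2] u) y)
      * (Even.neg_one_pow ⟨k, rfl⟩ : (-1 : ℝ) ^ (k + k) = 1)
  rw [htotal, hpull, zero_sub] at hlimit
  have hsign : (-1 : ℝ) ^ k ≠ 0 := by simp
  exact mul_left_cancel₀ (mul_ne_zero two_ne_zero hsign) (by linear_combination hlimit)

theorem sq_lintegral_le {X : Type*} [MeasurableSpace X] (ν : Measure X) {g : X → ENNReal}
    (hg : AEMeasurable g ν) : (∫⁻ y, g y ∂ν) ^ 2 ≤ ν univ * ∫⁻ y, g y ^ 2 ∂ν := by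
  have hholder := ENNReal.lintegral_mul_le_Lp_mul_Lq ν Real.HolderConjugate.two_two
    (f := fun _ => 1) aemeasurable_const hg
  simp only [Pi.mul_apply, one_mul, ENNReal.one_rpow, lintegral_const] at hholder
  calc (∫⁻ y, g y ∂ν) ^ 2
      ≤ (ν univ ^ (1 / 2 : ℝ) * (∫⁻ y, g y ^ (2 : ℝ) ∂ν) ^ (1 / 2 : ℝ)) ^ 2 := by gcongr
    _ = ν univ * ∫⁻ y, g y ^ 2 ∂ν := by
      rw [mul_pow, ← ENNReal.rpow_natCast, ← ENNReal.rpow_natCast, ← ENNReal.rpow_mul,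
        ← ENNReal.rpow_mul]
      simp

section AbsMeasure

variable {f : E n → ℝ}

/-- The measure `|f| dx`. -/
def absMeasure (f : E n → ℝ) : Measure (E n) :=
  volume.withDensity fun y => ‖f y‖ₑ

theorem lintegral_absMeasure (hf : Continuous f) (g : E n → ENNReal) :
    ∫⁻ y, g y ∂absMeasure f = ∫⁻ y, ‖f y‖ₑ * g y :=
  lintegral_withDensity_eq_lintegral_mul_non_measurable _ hf.measurable.enorm
    (Eventually.of_forall fun _ => enorm_lt_top) g

theorem isFiniteMeasure_absMeasure (hf : Integrable f) : IsFiniteMeasure (absMeasure f) :=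
  isFiniteMeasure_withDensity hf.2.ne

end AbsMeasure

section RieszKernel

variable {V : Type*} [NormedAddCommGroup V] [InnerProductSpace ℝ V]

/-- The gradient `z / ‖z‖²` of `log ‖z‖`, with the value `0` at the origin. -/
def rieszKernel (z : V) : V := (‖z‖ ^ 2)⁻¹ • z

theorem norm_rieszKernel (z : V) : ‖rieszKernel z‖ = ‖z‖⁻¹ := by
  rcases eq_or_ne z 0 with rfl | hz
  · simp [rieszKernel]
  · have : ‖z‖ ≠ 0 := norm_ne_zero_iff.2 hz
    rw [rieszKernel, norm_smul, norm_inv, norm_pow, norm_norm]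
    field_simp

theorem norm_rieszKernel_sub {x y : V} (hx : x ≠ 0) (hy : y ≠ 0) :
    ‖rieszKernel x - rieszKernel y‖ = ‖x - y‖ / (‖x‖ * ‖y‖) := by
  have hdist := dist_div_norm_sq_smul hx hy 1
  simp only [one_pow, one_div, inv_pow] at hdist
  rw [← dist_eq_norm, rieszKernel, rieszKernel, hdist, dist_eq_norm, inv_mul_eq_div]

theorem rieszKernel_smul (r : ℝ) (z : V) : rieszKernel (r • z) = r⁻¹ • rieszKernel z := by
  rcases eq_or_ne r 0 with rfl | hr
  · simp [rieszKernel]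
  · simp only [rieszKernel, norm_smul, mul_pow, smul_smul, Real.norm_eq_abs, sq_abs]
    congr 1
    field_simp

theorem rieszKernel_neg (z : V) : rieszKernel (-z) = -rieszKernel z := by
  simp [rieszKernel]

theorem continuousOn_rieszKernel : ContinuousOn (rieszKernel : V → V) {0}ᶜ :=
  ((continuous_norm.pow 2).continuousOn.inv₀ fun _ hx =>
    pow_ne_zero 2 (norm_ne_zero_iff.2 hx)).smul continuousOn_id

theorem measurable_rieszKernel : Measurable (rieszKernel : E n → E n) := by
  unfold rieszKernel
  fun_prop

theorem integrable_smul_rieszKernel (hn : 1 < n) {f : E n → ℝ} (hf : Integrable f)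
    (hc : Continuous f) (x : E n) : Integrable fun y => f y • rieszKernel (y - x) := by
  refine (integrable_div_norm hn hf hc x).mono' (hc.aestronglyMeasurable.smul
    (measurable_rieszKernel.comp (measurable_id.sub_const x)).aestronglyMeasurable)
    (ae_of_all _ fun y => ?_)
  rw [norm_smul, norm_rieszKernel, norm_sub_rev y x, Real.norm_eq_abs, div_eq_mul_inv]

end RieszKernel

/-- `u` is smooth and has the gradient of the logarithmic potential `x ↦ -∫ log ‖x - y‖ * f y` of
a continuous integrable density `f`. -/
structure IsLogPotential (u f : E n → ℝ) : Prop where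
  contDiff : ContDiff ℝ ∞ u
  integrable : Integrable f
  continuous : Continuous f
  gradient_eq : ∀ x, ∇ u x = ∫ y, f y • rieszKernel (y - x)

/-- With `α = ∫ f`, the gradient of the difference between the blow-down `u (R • ·)` of the
logarithmic potential of `f` and its expected limit `-α log ‖·‖`. -/
def blowDownError (u f : E n → ℝ) (R : ℝ) (x : E n) : E n :=
  ∇ (fun y => u (R • y)) x + (∫ y, f y) • rieszKernel x

/-- The square of the norm of `x ↦ ‖z‖ / ‖x - z‖` in `L²(B)`. -/
def kernelEnergy (B : Set (E n)) (z : E n) : ENNReal :=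
  ∫⁻ x in B, ENNReal.ofReal (‖z‖ ^ 2 / ‖x - z‖ ^ 2)

section BlowDown

variable {u f : E n → ℝ} {B : Set (E n)}

theorem contDiff_comp_smul (hu : ContDiff ℝ ∞ u) (r : ℝ) : ContDiff ℝ ∞ fun y => u (r • y) :=
  hu.comp (contDiff_const_smul r)

theorem continuousOn_blowDownError (hu : ContDiff ℝ ∞ u) (hB : (0 : E n) ∉ B) (R : ℝ) :
    ContinuousOn (blowDownError u f R) B :=
  (continuous_gradient (contDiff_comp_smul hu R) (by simp)).continuousOn.add
    ((continuousOn_rieszKernel.mono (subset_compl_singleton_iff.2 hB)).const_smul (∫ y, f y))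

theorem IsLogPotential.blowDownError_eq (hn : 1 < n) (h : IsLogPotential u f) {R : ℝ} (hR : R ≠ 0)
    (x : E n) :
    blowDownError u f R x = ∫ y, f y • (rieszKernel x - rieszKernel (x - R⁻¹ • y)) := by
  have hint : Integrable fun y => R • f y • rieszKernel (y - R • x) :=
    (integrable_smul_rieszKernel hn h.integrable h.continuous _).smul R
  rw [blowDownError, gradient_comp_smul (h.contDiff.differentiable (by simp)), h.gradient_eq,
    ← integral_smul, ← integral_smul_const, ← integral_add hint (h.integrable.smul_const _)]
  refine integral_congr_ae (ae_of_all _ fun y => ?_)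
  have hscale : x - R⁻¹ • y = R⁻¹ • -(y - R • x) := by
    rw [smul_neg, smul_sub, inv_smul_smul₀ hR, neg_sub]
  simp only [hscale, rieszKernel_smul, rieszKernel_neg, inv_inv]
  module

theorem IsLogPotential.enorm_blowDownError_le (hn : 1 < n) (h : IsLogPotential u f) {R : ℝ}
    (hR : R ≠ 0) {x : E n} (hx : x ≠ 0) :
    ‖blowDownError u f R x‖ₑ ≤ ENNReal.ofReal ‖x‖⁻¹
      * ∫⁻ y, ENNReal.ofReal (‖R⁻¹ • y‖ / ‖x - R⁻¹ • y‖) ∂absMeasure f := by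
  have : Nontrivial (E n) := nontrivial_of_ne x 0 hx
  rw [h.blowDownError_eq hn hR, lintegral_absMeasure h.continuous,
    ← lintegral_const_mul' _ _ ENNReal.ofReal_ne_top]
  refine (enorm_integral_le_lintegral_enorm _).trans_eq (lintegral_congr_ae ?_)
  filter_upwards [Measure.ae_ne volume (R • x)] with y hy
  have hxy : x - R⁻¹ • y ≠ 0 := by
    rwa [sub_ne_zero, ne_eq, eq_inv_smul_iff₀ hR, eq_comm]
  rw [enorm_smul, ← ofReal_norm (rieszKernel x - _), norm_rieszKernel_sub hx hxy, sub_sub_cancel,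
    mul_left_comm, ← ENNReal.ofReal_mul (by positivity), inv_mul_eq_div, div_div, mul_comm ‖x‖]

theorem measurable_kernelEnergy (B : Set (E n)) : Measurable (kernelEnergy B) :=
  Measurable.lintegral_prod_right'
    (f := fun p : E n × E n => ENNReal.ofReal (‖p.1‖ ^ 2 / ‖p.2 - p.1‖ ^ 2)) (by fun_prop)

theorem norm_sq_div_norm_sub_sq_le {x : E n} {r : ℝ} (hx : ‖x‖ ≤ r) (z : E n) :
    ‖z‖ ^ 2 / ‖x - z‖ ^ 2 ≤ 2 + 2 * r ^ 2 * (‖x - z‖ ^ 2)⁻¹ := by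
  rcases eq_or_ne (x - z) 0 with h | h
  · simp [h]
  · have : 0 < ‖x - z‖ := norm_pos_iff.2 h
    have htri : ‖z‖ ≤ ‖x - z‖ + r := by
      linarith [norm_sub_norm_le z x, norm_sub_rev z x]
    rw [div_le_iff₀ (by positivity), add_mul, inv_mul_cancel_right₀ (by positivity)]
    nlinarith [pow_le_pow_left₀ (norm_nonneg z) htri 2, sq_nonneg (‖x - z‖ - r)]

theorem exists_kernelEnergy_le (hn : 2 < n) (hB : IsCompact B) :
    ∃ A : ℝ, ∀ z, kernelEnergy B z ≤ ENNReal.ofReal A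
      ∧ kernelEnergy B z ≤ ENNReal.ofReal (‖z‖ ^ 2 * A) := by
  obtain ⟨r, hr⟩ := hB.isBounded.exists_norm_le
  obtain ⟨A, hA0, hA⟩ := exists_setLIntegral_inv_norm_sub_pow_le hn hB.measurableSet
    hB.measure_ne_top
  refine ⟨2 * volume.real B + (1 + 2 * r ^ 2) * A, fun z => ⟨?_, ?_⟩⟩
  · calc kernelEnergy B z
        ≤ ∫⁻ x in B, (ENNReal.ofReal 2
          + ENNReal.ofReal (2 * r ^ 2) * ENNReal.ofReal ((‖x - z‖ ^ 2)⁻¹)) := by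
          refine setLIntegral_mono (by fun_prop) fun x hx => ?_
          rw [← ENNReal.ofReal_mul (by positivity), ← ENNReal.ofReal_add (by positivity)
            (by positivity)]
          exact ENNReal.ofReal_le_ofReal (norm_sq_div_norm_sub_sq_le (hr x hx) z)
      _ ≤ ENNReal.ofReal 2 * volume B + ENNReal.ofReal (2 * r ^ 2) * ENNReal.ofReal A := by
          rw [lintegral_add_left measurable_const, setLIntegral_const,
            lintegral_const_mul _ (by fun_prop)]
          gcongr
          exact hA z
      _ ≤ ENNReal.ofReal (2 * volume.real B + (1 + 2 * r ^ 2) * A) := by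
          rw [← ofReal_measureReal hB.measure_ne_top, ← ENNReal.ofReal_mul (by positivity),
            ← ENNReal.ofReal_mul (by positivity), ← ENNReal.ofReal_add (by positivity)
            (by positivity)]
          exact ENNReal.ofReal_le_ofReal (by linarith)
  · calc kernelEnergy B z
        = ENNReal.ofReal (‖z‖ ^ 2) * ∫⁻ x in B, ENNReal.ofReal ((‖x - z‖ ^ 2)⁻¹) := by
          rw [← lintegral_const_mul _ (by fun_prop)]
          simp only [kernelEnergy, div_eq_mul_inv, ENNReal.ofReal_mul (sq_nonneg ‖z‖)]
      _ ≤ ENNReal.ofReal (‖z‖ ^ 2) * ENNReal.ofReal A := by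
          gcongr
          exact hA z
      _ ≤ ENNReal.ofReal (‖z‖ ^ 2 * (2 * volume.real B + (1 + 2 * r ^ 2) * A)) := by
          rw [← ENNReal.ofReal_mul (by positivity)]
          refine ENNReal.ofReal_le_ofReal (mul_le_mul_of_nonneg_left ?_ (by positivity))
          nlinarith [measureReal_nonneg (μ := volume) (s := B), mul_nonneg (sq_nonneg r) hA0]

theorem tendsto_lintegral_kernelEnergy (hn : 2 < n) (hB : IsCompact B) (μ : Measure (E n))
    [IsFiniteMeasure μ] :
    Tendsto (fun R : ℝ => ∫⁻ y, kernelEnergy B (R⁻¹ • y) ∂μ) atTop (𝓝 0) := by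
  obtain ⟨A, hA⟩ := exists_kernelEnergy_le hn hB
  rw [← lintegral_zero (μ := μ)]
  refine tendsto_lintegral_filter_of_dominated_convergence (fun _ => ENNReal.ofReal A)
    (Eventually.of_forall fun R => (measurable_kernelEnergy B).comp (measurable_const_smul _))
    (Eventually.of_forall fun R => ae_of_all _ fun y => (hA _).1) ?_ (ae_of_all _ fun y => ?_)
  · rw [lintegral_const]
    exact ENNReal.mul_ne_top ENNReal.ofReal_ne_top (measure_ne_top _ _)
  · have hlim : Tendsto (fun R : ℝ => ENNReal.ofReal (‖R⁻¹ • y‖ ^ 2 * A)) atTop (𝓝 0) := by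
      simpa using ENNReal.tendsto_ofReal
        ((((tendsto_inv_atTop_zero (𝕜 := ℝ)).smul_const y).norm.pow 2).mul_const A)
    exact tendsto_of_tendsto_of_tendsto_of_le_of_le tendsto_const_nhds hlim (fun _ => zero_le)
      fun R => (hA _).2

theorem IsLogPotential.setLIntegral_enorm_blowDownError_sq_le (hn : 1 < n)
    (h : IsLogPotential u f) {δ : ℝ} (hδ : 0 < δ) (hBδ : ∀ x ∈ B, δ ≤ ‖x‖) {R : ℝ} (hR : R ≠ 0) :
    ∫⁻ x in B, ‖blowDownError u f R x‖ₑ ^ 2 ≤ ENNReal.ofReal δ⁻¹ ^ 2 * (absMeasure f univ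
      * ∫⁻ y, kernelEnergy B (R⁻¹ • y) ∂absMeasure f) := by
  have := isFiniteMeasure_absMeasure h.integrable
  have hmeas : Measurable fun p : E n × E n =>
      ENNReal.ofReal (‖R⁻¹ • p.2‖ ^ 2 / ‖p.1 - R⁻¹ • p.2‖ ^ 2) := by fun_prop
  have hpoint : ∀ x ∈ B, ‖blowDownError u f R x‖ₑ ^ 2 ≤ ENNReal.ofReal δ⁻¹ ^ 2
      * (absMeasure f univ
        * ∫⁻ y, ENNReal.ofReal (‖R⁻¹ • y‖ ^ 2 / ‖x - R⁻¹ • y‖ ^ 2) ∂absMeasure f) := by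
    intro x hx
    have hx0 : 0 < ‖x‖ := hδ.trans_le (hBδ x hx)
    refine (pow_le_pow_left' (h.enorm_blowDownError_le hn hR (norm_pos_iff.1 hx0)) 2).trans ?_
    rw [mul_pow]
    gcongr
    · exact hBδ x hx
    · refine (sq_lintegral_le _ (by fun_prop)).trans_eq ?_
      simp only [← ENNReal.ofReal_pow (div_nonneg (norm_nonneg _) (norm_nonneg _)), div_pow]
  refine (setLIntegral_mono ((hmeas.lintegral_prod_right'.const_mul _).const_mul _)
    hpoint).trans_eq ?_
  rw [lintegral_const_mul _ (hmeas.lintegral_prod_right'.const_mul _),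
    lintegral_const_mul _ hmeas.lintegral_prod_right', lintegral_lintegral_swap hmeas.aemeasurable]
  rfl

theorem IsLogPotential.tendsto_setLIntegral_enorm_blowDownError_sq (hn : 2 < n)
    (h : IsLogPotential u f) (hBc : IsCompact B) (hB : (0 : E n) ∉ B) :
    Tendsto (fun R : ℝ => ∫⁻ x in B, ‖blowDownError u f R x‖ₑ ^ 2) atTop (𝓝 0) := by
  have := isFiniteMeasure_absMeasure h.integrable
  obtain ⟨δ, hδ, hδB⟩ := Metric.mem_nhds_iff.1 (hBc.isClosed.isOpen_compl.mem_nhds hB)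
  have hBδ : ∀ x ∈ B, δ ≤ ‖x‖ := fun x hx => by
    by_contra! hlt
    exact hδB (mem_ball_zero_iff.2 hlt) hx
  have hlim : Tendsto (fun R : ℝ => ENNReal.ofReal δ⁻¹ ^ 2 * (absMeasure f univ
      * ∫⁻ y, kernelEnergy B (R⁻¹ • y) ∂absMeasure f)) atTop (𝓝 0) := by
    simpa using ENNReal.Tendsto.const_mul (a := ENNReal.ofReal δ⁻¹ ^ 2)
      (ENNReal.Tendsto.const_mul (tendsto_lintegral_kernelEnergy hn hBc (absMeasure f))
        (Or.inr (measure_ne_top (absMeasure f) univ)))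
      (Or.inr (ENNReal.pow_ne_top ENNReal.ofReal_ne_top))
  refine tendsto_of_tendsto_of_tendsto_of_le_of_le' tendsto_const_nhds hlim
    (Eventually.of_forall fun _ => zero_le) ?_
  filter_upwards [eventually_ne_atTop 0] with R hR
  exact h.setLIntegral_enorm_blowDownError_sq_le (by omega) hδ hBδ hR

end BlowDown

/-- The function `-Δu - (n - 2)/2 ‖∇u‖²`, which is `1 / (2 (n - 1))` times `R e^{2u}` for the scalar
curvature `R` of `e^{2u} |dx|²`. -/
def scalarDensity (u : E n → ℝ) (x : E n) : ℝ :=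
  -Δ u x - ((n : ℝ) - 2) / 2 * ‖∇ u x‖ ^ 2

section ScalarDensity

variable {u : E n → ℝ}

theorem scalarCurvature_conformalMetric_mul_exp_eq_scalarDensity (hu : ContDiff ℝ ∞ u) (x : E n) :
    scalarCurvature (conformalMetric u) x * Real.exp (2 * u x)
      = 2 * ((n : ℝ) - 1) * scalarDensity u x := by
  rw [scalarCurvature_conformalMetric_mul_exp hu, sum_partialDeriv_sq, scalarDensity]
  ring

theorem continuous_scalarDensity (hu : ContDiff ℝ ∞ u) : Continuous (scalarDensity u) :=
  (contDiff_laplacian hu).continuous.neg.sub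
    (((continuous_gradient hu (by simp)).norm.pow 2).const_mul _)

theorem partialDeriv_comp_smul (i : Fin n) (u : E n → ℝ) (r : ℝ) :
    partialDeriv i (fun y => u (r • y)) = r • fun y => partialDeriv i u (r • y) := by
  ext x
  simp [partialDeriv, fderiv_comp_smul]

theorem laplacian_comp_smul (hu : ContDiff ℝ ∞ u) (r : ℝ) (x : E n) :
    Δ (fun y => u (r • y)) x = r ^ 2 * Δ u (r • x) := by
  have hpartial (i : Fin n) : partialDeriv i (partialDeriv i fun y => u (r • y)) x
      = r ^ 2 * partialDeriv i (partialDeriv i u) (r • x) := by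
    have hsmooth : ContDiff ℝ ∞ fun y => partialDeriv i u (r • y) :=
      contDiff_comp_smul (contDiff_partialDeriv i hu) r
    rw [partialDeriv_comp_smul, partialDeriv,
      fderiv_const_smul (hsmooth.differentiable (by simp) x), smul_apply, ← partialDeriv,
      partialDeriv_comp_smul, Pi.smul_apply]
    simp only [smul_eq_mul]
    ring
  simp only [laplacian_eq_sum hu, laplacian_eq_sum (contDiff_comp_smul hu r), hpartial,
    Finset.mul_sum]

theorem scalarDensity_comp_smul (hu : ContDiff ℝ ∞ u) (r : ℝ) (x : E n) :
    scalarDensity (fun y => u (r • y)) x = r ^ 2 * scalarDensity u (r • x) := by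
  rw [scalarDensity, scalarDensity, laplacian_comp_smul hu,
    gradient_comp_smul (hu.differentiable (by simp)), norm_smul, mul_pow, Real.norm_eq_abs, sq_abs]
  ring

end ScalarDensity

section SquareIntegral

variable {X ι V : Type*} [MeasurableSpace X] {μ : Measure X} {l : Filter ι} [NormedAddCommGroup V]
  {D : ι → X → V}

theorem tendsto_integral_inner_of_tendsto_lintegral_sq [InnerProductSpace ℝ V] {w : X → V}
    (hw : MemLp w 2 μ) (hDm : ∀ i, AEStronglyMeasurable (D i) μ)
    (hD : Tendsto (fun i => ∫⁻ x, ‖D i x‖ₑ ^ 2 ∂μ) l (𝓝 0)) :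
    Tendsto (fun i => ∫ x, ⟪w x, D i x⟫_ℝ ∂μ) l (𝓝 0) := by
  have hbound (i : ι) : ‖∫ x, ⟪w x, D i x⟫_ℝ ∂μ‖ₑ
      ≤ (∫⁻ x, ‖w x‖ₑ ^ 2 ∂μ) ^ (1 / 2 : ℝ) * (∫⁻ x, ‖D i x‖ₑ ^ 2 ∂μ) ^ (1 / 2 : ℝ) := by
    have hholder := ENNReal.lintegral_mul_le_Lp_mul_Lq μ Real.HolderConjugate.two_two
      hw.1.enorm (hDm i).enorm
    simp only [ENNReal.rpow_ofNat] at hholder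
    refine ((enorm_integral_le_lintegral_enorm _).trans (lintegral_mono fun x => ?_)).trans hholder
    simp only [Pi.mul_apply, ← ofReal_norm, ← ENNReal.ofReal_mul (norm_nonneg _)]
    exact ENNReal.ofReal_le_ofReal (norm_inner_le_norm _ _)
  have hw' : (∫⁻ x, ‖w x‖ₑ ^ 2 ∂μ) ^ (1 / 2 : ℝ) ≠ ⊤ := by
    have hlt := lintegral_rpow_enorm_lt_top_of_eLpNorm_lt_top two_ne_zero ENNReal.ofNat_ne_top hw.2
    simp only [ENNReal.toReal_ofNat, ENNReal.rpow_ofNat] at hlt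
    exact ENNReal.rpow_ne_top_of_nonneg (by norm_num) hlt.ne
  rw [tendsto_zero_iff_enorm_tendsto_zero]
  refine tendsto_of_tendsto_of_tendsto_of_le_of_le tendsto_const_nhds ?_ (fun _ => zero_le) hbound
  simpa using ENNReal.Tendsto.const_mul (hD.ennrpow_const (1 / 2)) (Or.inr hw')

theorem tendsto_integral_mul_norm_sq_of_tendsto_lintegral_sq {φ : X → ℝ} {M : ℝ}
    (hφ : ∀ x, |φ x| ≤ M) (hD : Tendsto (fun i => ∫⁻ x, ‖D i x‖ₑ ^ 2 ∂μ) l (𝓝 0)) :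
    Tendsto (fun i => ∫ x, φ x * ‖D i x‖ ^ 2 ∂μ) l (𝓝 0) := by
  have hbound (i : ι) : ‖∫ x, φ x * ‖D i x‖ ^ 2 ∂μ‖ₑ
      ≤ ENNReal.ofReal M * ∫⁻ x, ‖D i x‖ₑ ^ 2 ∂μ := by
    rw [← lintegral_const_mul' _ _ ENNReal.ofReal_ne_top]
    refine (enorm_integral_le_lintegral_enorm _).trans (lintegral_mono fun x => ?_)
    rw [enorm_mul, enorm_pow, enorm_norm, ← ofReal_norm]
    gcongr
    exact hφ x
  rw [tendsto_zero_iff_enorm_tendsto_zero]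
  refine tendsto_of_tendsto_of_tendsto_of_le_of_le tendsto_const_nhds ?_ (fun _ => zero_le) hbound
  simpa using ENNReal.Tendsto.const_mul hD (Or.inr ENNReal.ofReal_ne_top)

end SquareIntegral

section Energy

variable {φ : E n → ℝ} (hφ : ContDiff ℝ ∞ φ) (hc : HasCompactSupport φ)

theorem exists_contDiff_gradient_eq_rieszKernel {B : Set (E n)} (hB : IsClosed B) (h0 : 0 ∉ B) :
    ∃ ψ : E n → ℝ, ContDiff ℝ ∞ ψ ∧ ∀ x ∈ B, ∇ ψ x = (2 : ℝ) • rieszKernel x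
      ∧ Δ ψ x = 2 * ((n : ℝ) - 2) * (‖x‖ ^ 2)⁻¹ := by
  obtain ⟨δ, hδ, hball⟩ := Metric.mem_nhds_iff.1 (hB.isOpen_compl.mem_nhds h0)
  set a : ℝ := 2 * (δ ^ 2)⁻¹ with ha
  have hlt {x : E n} (hx : x ∈ B) : 1 < a * ‖x‖ ^ 2 := by
    have hδx : δ ≤ ‖x‖ := by
      by_contra! hx'
      exact hball (mem_ball_zero_iff.2 hx') hx
    calc (1 : ℝ) < 2 := one_lt_two
      _ = a * δ ^ 2 := by rw [ha]; field_simp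
      _ ≤ a * ‖x‖ ^ 2 := by gcongr
  have hderiv {x : E n} (hx : x ∈ B) :
      deriv (fun t => smoothLog (a * t)) (‖x‖ ^ 2) = (‖x‖ ^ 2)⁻¹ := by
    rw [deriv_comp_mul_left, deriv_smoothLog (hlt hx), smul_eq_mul, mul_inv,
      mul_inv_cancel_left₀ (by positivity)]
  have hsmooth := contDiff_smoothLog_const_mul a
  refine ⟨fun y => smoothLog (a * ‖y - 0‖ ^ 2), contDiff_radial hsmooth 0, fun x hx => ⟨?_, ?_⟩⟩
  · ext i
    rw [gradient_apply, partialDeriv_radial i (hsmooth.differentiable (by simp)), sub_zero,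
      hderiv hx]
    simp only [rieszKernel, PiLp.smul_apply, smul_eq_mul]
    ring
  · rw [laplacian_radial hsmooth]
    simp only [sub_zero]
    rw [radialLaplacian_comp_const_mul]
    simp only [radialLaplacian_smoothLog (hlt hx), mul_inv]
    rw [mul_left_comm, mul_inv_cancel_left₀ (by positivity)]
    ring

theorem inner_sub_mul_norm_sq_eq {V : Type*} [NormedAddCommGroup V] [InnerProductSpace ℝ V]
    (w v K : V) (c α t : ℝ) :
    ⟪w, v⟫_ℝ - c * (t * ‖v‖ ^ 2)
      = ⟪w + (2 * c * α * t) • K, v + α • K⟫_ℝ - c * (t * ‖v + α • K‖ ^ 2) - α * ⟪w, K⟫_ℝ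
        - c * α ^ 2 * (t * ‖K‖ ^ 2) := by
  rw [norm_add_sq_real, norm_smul, mul_pow, Real.norm_eq_abs, sq_abs]
  simp only [inner_add_left, inner_add_right, inner_smul_left, inner_smul_right, conj_trivial,
    real_inner_self_eq_norm_sq, real_inner_comm v K]
  ring

theorem setIntegral_inner_sub_mul_norm_sq_eq {X V : Type*} [TopologicalSpace X] [T2Space X]
    [MeasurableSpace X] [OpensMeasurableSpace X] {μ : Measure X} [IsFiniteMeasureOnCompacts μ]
    [NormedAddCommGroup V] [InnerProductSpace ℝ V] {B : Set X} (hB : IsCompact B) {w v K : X → V}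
    {t : X → ℝ} (hw : ContinuousOn w B) (hv : ContinuousOn v B) (hK : ContinuousOn K B)
    (ht : ContinuousOn t B) (c α : ℝ) :
    ∫ x in B, (⟪w x, v x⟫_ℝ - c * (t x * ‖v x‖ ^ 2)) ∂μ
      = (∫ x in B, ⟪w x + (2 * c * α * t x) • K x, v x + α • K x⟫_ℝ ∂μ)
        - c * (∫ x in B, t x * ‖v x + α • K x‖ ^ 2 ∂μ) - α * (∫ x in B, ⟪w x, K x⟫_ℝ ∂μ)
        - c * α ^ 2 * ∫ x in B, t x * ‖K x‖ ^ 2 ∂μ := by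
  have hD : ContinuousOn (fun x => v x + α • K x) B := hv.add (hK.const_smul α)
  have hW : ContinuousOn (fun x => w x + (2 * c * α * t x) • K x) B :=
    hw.add ((continuousOn_const.mul ht).smul hK)
  have hi₁ := (hW.inner (𝕜 := ℝ) hD).integrableOn_compact (μ := μ) hB
  have hi₂ := ((ht.fun_mul (hD.norm.fun_pow 2)).integrableOn_compact (μ := μ) hB).const_mul c
  have hi₃ := ((hw.inner (𝕜 := ℝ) hK).integrableOn_compact (μ := μ) hB).const_mul α
  have hi₄ := ((ht.fun_mul (hK.norm.fun_pow 2)).integrableOn_compact (μ := μ) hB).const_mul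
    (c * α ^ 2)
  simp only [fun x => inner_sub_mul_norm_sq_eq (w x) (v x) (K x) c α (t x)]
  rw [integral_sub ((hi₁.fun_sub hi₂).fun_sub hi₃) hi₄, integral_sub (hi₁.fun_sub hi₂) hi₃,
    integral_sub hi₁ hi₂, integral_const_mul, integral_const_mul, integral_const_mul]

theorem gradient_eq_zero_of_notMem_tsupport {x : E n} (hx : x ∉ tsupport φ) : ∇ φ x = 0 := by
  rw [gradient, fderiv_of_notMem_tsupport ℝ hx, map_zero]

include hφ hc

theorem integral_inner_gradient_rieszKernel (h0 : 0 ∉ tsupport φ) :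
    ∫ x, ⟪∇ φ x, rieszKernel x⟫_ℝ = -(((n : ℝ) - 2) * ∫ x, φ x * (‖x‖ ^ 2)⁻¹) := by
  obtain ⟨ψ, hψ, hψB⟩ := exists_contDiff_gradient_eq_rieszKernel (isClosed_tsupport φ) h0
  have hlap : ∫ x, φ x * Δ ψ x = 2 * (((n : ℝ) - 2) * ∫ x, φ x * (‖x‖ ^ 2)⁻¹) := by
    rw [← integral_const_mul, ← integral_const_mul]
    congr with x
    by_cases hx : x ∈ tsupport φ
    · rw [(hψB x hx).2]
      ring
    · simp [image_eq_zero_of_notMem_tsupport hx]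
  have hgrad : ∫ x, ⟪∇ φ x, ∇ ψ x⟫_ℝ = 2 * ∫ x, ⟪∇ φ x, rieszKernel x⟫_ℝ := by
    rw [← integral_const_mul]
    congr with x
    by_cases hx : x ∈ tsupport φ
    · rw [(hψB x hx).1, inner_smul_right]
    · simp [gradient_eq_zero_of_notMem_tsupport hx]
  linarith [integral_mul_laplacian_eq_neg_inner hφ hc hψ]

theorem integral_mul_scalarDensity {v : E n → ℝ} (hv : ContDiff ℝ ∞ v) :
    ∫ x, φ x * scalarDensity v x
      = ∫ x, (⟪∇ φ x, ∇ v x⟫_ℝ - ((n : ℝ) - 2) / 2 * (φ x * ‖∇ v x‖ ^ 2)) := by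
  have hgφ := continuous_gradient hφ (by simp)
  have hgv := continuous_gradient hv (by simp)
  have hlap : Integrable fun x => -(φ x * Δ v x) :=
    ((hφ.continuous.mul (contDiff_laplacian hv).continuous).integrable_of_hasCompactSupport
      hc.mul_right).neg
  have hsq : Integrable fun x => ((n : ℝ) - 2) / 2 * (φ x * ‖∇ v x‖ ^ 2) :=
    ((hφ.continuous.mul (hgv.norm.pow 2)).integrable_of_hasCompactSupport hc.mul_right).const_mul _
  have hinner : Integrable fun x => ⟪∇ φ x, ∇ v x⟫_ℝ :=
    (hgφ.inner hgv).integrable_of_hasCompactSupport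
      ((hasCompactSupport_gradient hc).mono fun x hx hzero => hx (by simp [hzero]))
  calc ∫ x, φ x * scalarDensity v x
      = ∫ x, (-(φ x * Δ v x) - ((n : ℝ) - 2) / 2 * (φ x * ‖∇ v x‖ ^ 2)) := by
        congr with x
        rw [scalarDensity]
        ring
    _ = _ := by
        rw [integral_sub hlap hsq, integral_neg, integral_mul_laplacian_eq_neg_inner hφ hc hv,
          neg_neg, integral_sub hinner hsq]

theorem integral_mul_scalarDensity_eq_add_rieszKernel (h0 : 0 ∉ tsupport φ) {v : E n → ℝ}
    (hv : ContDiff ℝ ∞ v) (α : ℝ) :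
    ∫ x, φ x * scalarDensity v x
      = (∫ x in tsupport φ, ⟪∇ φ x + (((n : ℝ) - 2) * α * φ x) • rieszKernel x,
            ∇ v x + α • rieszKernel x⟫_ℝ)
        - ((n : ℝ) - 2) / 2 * (∫ x in tsupport φ, φ x * ‖∇ v x + α • rieszKernel x‖ ^ 2)
        + ((n : ℝ) - 2) * (α - α ^ 2 / 2) * ∫ x, φ x * (‖x‖ ^ 2)⁻¹ := by
  have hK := continuousOn_rieszKernel.mono (subset_compl_singleton_iff.2 h0)
  have hinner := setIntegral_eq_integral_of_forall_compl_eq_zero (μ := volume)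
    (f := fun x => ⟪∇ φ x, rieszKernel x⟫_ℝ) (s := tsupport φ)
    fun x hx => by rw [gradient_eq_zero_of_notMem_tsupport hx, inner_zero_left]
  have hsq := setIntegral_eq_integral_of_forall_compl_eq_zero (μ := volume)
    (f := fun x => φ x * (‖x‖ ^ 2)⁻¹) (s := tsupport φ)
    fun x hx => by rw [image_eq_zero_of_notMem_tsupport hx, zero_mul]
  rw [integral_mul_scalarDensity hφ hc hv,
    ← setIntegral_eq_integral_of_forall_compl_eq_zero (s := tsupport φ) fun x hx => by
      simp [gradient_eq_zero_of_notMem_tsupport hx, image_eq_zero_of_notMem_tsupport hx],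
    setIntegral_inner_sub_mul_norm_sq_eq hc (continuous_gradient hφ (by simp)).continuousOn
      (continuous_gradient hv (by simp)).continuousOn hK hφ.continuous.continuousOn _ α, hinner,
    integral_inner_gradient_rieszKernel hφ hc h0]
  simp only [norm_rieszKernel, inv_pow, mul_div_cancel₀ _ (two_ne_zero' ℝ), hsq]
  ring

/- The blow-down `u (R • ·)` behaves like `-α log ‖·‖`, whose scalar density is
`(n - 2) (α - α² / 2) ‖·‖⁻²`. -/
theorem IsLogPotential.tendsto_integral_mul_scalarDensity {u f : E n → ℝ} (hn : 2 < n)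
    (h : IsLogPotential u f) (h0 : 0 ∉ tsupport φ) :
    Tendsto (fun R => ∫ x, φ x * (R ^ 2 * scalarDensity u (R • x))) atTop
      (𝓝 (((n : ℝ) - 2) * ((∫ y, f y) - (∫ y, f y) ^ 2 / 2) * ∫ x, φ x * (‖x‖ ^ 2)⁻¹)) := by
  have hB : IsCompact (tsupport φ) := hc
  obtain ⟨M, hM⟩ := hφ.continuous.bounded_above_of_compact_support hc
  have hsq := h.tendsto_setLIntegral_enorm_blowDownError_sq hn hB h0
  have hK := continuousOn_rieszKernel.mono (subset_compl_singleton_iff.2 h0)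
  have hw : ContinuousOn
      (fun x => ∇ φ x + (((n : ℝ) - 2) * (∫ y, f y) * φ x) • rieszKernel x) (tsupport φ) :=
    (continuous_gradient hφ (by simp)).continuousOn.add
      ((hφ.continuous.const_mul _).continuousOn.smul hK)
  have hw2 := (memLp_two_iff_integrable_sq_norm
    (hw.aestronglyMeasurable (μ := volume) hB.measurableSet)).2
    ((hw.norm.pow 2).integrableOn_compact hB)
  have hlinear := tendsto_integral_inner_of_tendsto_lintegral_sq hw2
    (fun R => (continuousOn_blowDownError h.contDiff h0 R).aestronglyMeasurable hB.measurableSet)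
    hsq
  have hquadratic := tendsto_integral_mul_norm_sq_of_tendsto_lintegral_sq hM hsq
  have hlim := (hlinear.sub (hquadratic.const_mul (((n : ℝ) - 2) / 2))).add_const
    (((n : ℝ) - 2) * ((∫ y, f y) - (∫ y, f y) ^ 2 / 2) * ∫ x, φ x * (‖x‖ ^ 2)⁻¹)
  rw [mul_zero, sub_zero, zero_add] at hlim
  refine hlim.congr fun R => ?_
  simp only [← scalarDensity_comp_smul h.contDiff]
  exact (integral_mul_scalarDensity_eq_add_rieszKernel hφ hc h0
    (contDiff_comp_smul h.contDiff R) _).symm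

end Energy

section LogEstimates

variable {V : Type*} [NormedAddCommGroup V]

theorem abs_log_le {t : ℝ} (ht : 0 < t) : |Real.log t| ≤ t + t⁻¹ := by
  have hlog := Real.log_le_sub_one_of_pos ht
  have hlog_inv := Real.log_le_sub_one_of_pos (inv_pos.2 ht)
  rw [Real.log_inv] at hlog_inv
  have hinv := inv_pos.2 ht
  exact abs_le.2 ⟨by linarith, by linarith⟩

theorem abs_log_norm_sub_log_norm_sub_le {x y : V} (hx : x ≠ 0) (hxy : 2 * ‖y‖ ≤ ‖x‖) :
    |Real.log ‖x‖ - Real.log ‖x - y‖| ≤ Real.log 2 := by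
  have hx0 : 0 < ‖x‖ := norm_pos_iff.2 hx
  have hupper : ‖x - y‖ ≤ ‖x‖ + ‖y‖ := norm_sub_le x y
  have hlower : ‖x‖ - ‖y‖ ≤ ‖x - y‖ := norm_sub_norm_le x y
  have hd0 : 0 < ‖x - y‖ := by linarith
  have hle : Real.log ‖x‖ ≤ Real.log (2 * ‖x - y‖) := Real.log_le_log hx0 (by linarith)
  have hge : Real.log ‖x - y‖ ≤ Real.log (2 * ‖x‖) := Real.log_le_log hd0 (by linarith)
  rw [Real.log_mul two_ne_zero (by positivity)] at hle hge
  exact abs_le.2 ⟨by linarith, by linarith⟩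

theorem log_two_le_one : Real.log 2 ≤ 1 := by
  linarith [Real.log_le_sub_one_of_pos two_pos]

theorem abs_log_norm_add_log_norm_sub_log_norm_sub_le {x y : V} (hx : 1 ≤ ‖x‖) (hy : 1 ≤ ‖y‖)
    (hxy : x ≠ y) :
    |Real.log ‖y‖ - Real.log ‖x - y‖ + Real.log ‖x‖|
      ≤ 1 + (Real.log ‖x‖ + Real.log (1 + ‖x‖ / ‖x - y‖)) := by
  have hx0 : 0 < ‖x‖ := by linarith
  have hy0 : 0 < ‖y‖ := by linarith
  have hd0 : 0 < ‖x - y‖ := norm_pos_iff.2 (sub_ne_zero.2 hxy)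
  have hle : Real.log ‖y‖ ≤ Real.log ((1 + ‖x‖ / ‖x - y‖) * ‖x - y‖) := by
    refine Real.log_le_log hy0 ?_
    rw [add_mul, one_mul, div_mul_cancel₀ _ hd0.ne']
    linarith [norm_sub_norm_le y x, norm_sub_rev x y]
  have hge : Real.log ‖x - y‖ ≤ Real.log (2 * (‖x‖ * ‖y‖)) :=
    Real.log_le_log hd0 (by nlinarith [norm_sub_le x y])
  rw [Real.log_mul (by positivity) hd0.ne'] at hle
  rw [Real.log_mul two_ne_zero (by positivity), Real.log_mul hx0.ne' hy0.ne'] at hge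
  have hlog : 0 ≤ Real.log ‖x‖ := Real.log_nonneg hx
  have hratio : 0 ≤ Real.log (1 + ‖x‖ / ‖x - y‖) :=
    Real.log_nonneg (le_add_of_nonneg_right (by positivity))
  have hlog_two := log_two_le_one
  exact abs_le.2 ⟨by linarith, by linarith⟩

theorem abs_log_norm_add_log_norm_sub_log_norm_sub_le_indicator {x y : V} {r : ℝ} (hr : 1 ≤ r)
    (hx : 2 * r ≤ ‖x‖) (hy : y ≠ 0) (hxy : x ≠ y) :
    |Real.log ‖y‖ - Real.log ‖x - y‖ + Real.log ‖x‖|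
      ≤ r + 1 + ‖y‖⁻¹ + {y : V | r < ‖y‖}.indicator
          (fun y => Real.log ‖x‖ + Real.log (1 + ‖x‖ / ‖x - y‖)) y := by
  have hy0 : 0 < ‖y‖ := norm_pos_iff.2 hy
  have hinv := inv_pos.2 hy0
  by_cases hyr : r < ‖y‖
  · rw [indicator_of_mem (show y ∈ {y : V | r < ‖y‖} from hyr)]
    linarith [abs_log_norm_add_log_norm_sub_log_norm_sub_le (by linarith : 1 ≤ ‖x‖)
      (hr.trans hyr.le) hxy]
  · rw [indicator_of_notMem (show y ∉ {y : V | r < ‖y‖} from hyr), add_zero]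
    have hx0 : x ≠ 0 := norm_pos_iff.1 (by linarith)
    calc |Real.log ‖y‖ - Real.log ‖x - y‖ + Real.log ‖x‖|
        = |Real.log ‖y‖ + (Real.log ‖x‖ - Real.log ‖x - y‖)| := by ring_nf
      _ ≤ |Real.log ‖y‖| + |Real.log ‖x‖ - Real.log ‖x - y‖| := abs_add_le _ _
      _ ≤ ‖y‖ + ‖y‖⁻¹ + 1 := add_le_add (abs_log_le hy0)
          ((abs_log_norm_sub_log_norm_sub_le hx0 (by linarith)).trans log_two_le_one)
      _ ≤ r + 1 + ‖y‖⁻¹ := by linarith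

end LogEstimates

section SegmentIntegral

variable {V : Type*} [NormedAddCommGroup V] [InnerProductSpace ℝ V]

theorem abs_inner_rieszKernel_le (z x : V) : |⟪rieszKernel z, x⟫_ℝ| ≤ ‖x‖ / ‖z‖ := by
  refine (abs_real_inner_le_norm _ _).trans_eq ?_
  rw [norm_rieszKernel, div_eq_inv_mul]

theorem hasDerivAt_neg_log_norm_sub_smul {x y : V} {t : ℝ} (h : y - t • x ≠ 0) :
    HasDerivAt (fun t : ℝ => -Real.log ‖y - t • x‖) ⟪rieszKernel (y - t • x), x⟫_ℝ t := by
  have hline : HasDerivAt (fun t : ℝ => y - t • x) (-x) t := by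
    simpa using ((hasDerivAt_id t).smul_const x).const_sub y
  have hsq : ‖y - t • x‖ ^ 2 ≠ 0 := pow_ne_zero 2 (norm_ne_zero_iff.2 h)
  have hlog := (hline.norm_sq.log hsq).const_mul (-(1 / 2))
  simp only [Real.log_pow] at hlog
  refine (hlog.congr_deriv ?_).congr_of_eventuallyEq (Eventually.of_forall fun t => ?_)
  · rw [rieszKernel, inner_smul_left, inner_neg_right, conj_trivial]
    ring
  · push_cast
    ring

theorem intervalIntegral_inner_rieszKernel {x y : V} (h : ∀ t : ℝ, y - t • x ≠ 0) :
    ∫ t in (0 : ℝ)..1, ⟪rieszKernel (y - t • x), x⟫_ℝ = Real.log ‖y‖ - Real.log ‖x - y‖ := by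
  have hcont : Continuous fun t : ℝ => ⟪rieszKernel (y - t • x), x⟫_ℝ :=
    (continuousOn_rieszKernel.comp_continuous (by fun_prop) h).inner continuous_const
  rw [intervalIntegral.integral_eq_sub_of_hasDerivAt
    (fun t _ => hasDerivAt_neg_log_norm_sub_smul (h t)) (hcont.intervalIntegrable _ _),
    zero_smul, sub_zero, one_smul, norm_sub_rev x y]
  ring

theorem ae_forall_sub_smul_ne_zero [FiniteDimensional ℝ V] [MeasurableSpace V] [BorelSpace V]
    (hV : 1 < Module.finrank ℝ V) (x : V) : ∀ᵐ y : V, ∀ t : ℝ, y - t • x ≠ 0 := by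
  have hline : volume (Submodule.span ℝ {x} : Set V) = 0 := by
    refine Measure.addHaar_submodule _ _ fun htop => hV.not_ge ?_
    rw [← finrank_top ℝ V, ← htop]
    exact (finrank_span_le_card {x}).trans_eq (by simp)
  rw [ae_iff]
  refine measure_mono_null (fun y hy => ?_) hline
  obtain ⟨t, ht⟩ : ∃ t : ℝ, y - t • x = 0 := by simpa using hy
  exact Submodule.mem_span_singleton.2 ⟨t, (sub_eq_zero.1 ht).symm⟩

theorem sub_eq_intervalIntegral_inner_gradient [CompleteSpace V] {u : V → ℝ} (hu : ContDiff ℝ 1 u)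
    (x : V) : u x - u 0 = ∫ t in (0 : ℝ)..1, ⟪∇ u (t • x), x⟫_ℝ := by
  have hderiv (t : ℝ) : HasDerivAt (fun t : ℝ => u (t • x)) ⟪∇ u (t • x), x⟫_ℝ t := by
    have hline : HasDerivAt (fun t : ℝ => t • x) x t := by
      simpa using (hasDerivAt_id t).smul_const x
    rw [inner_gradient_left]
    exact (hu.differentiable one_ne_zero (t • x)).hasFDerivAt.comp_hasDerivAt t hline
  have hcont : Continuous fun t : ℝ => ⟪∇ u (t • x), x⟫_ℝ :=
    ((continuous_gradient hu one_ne_zero).comp (by fun_prop)).inner continuous_const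
  rw [intervalIntegral.integral_eq_sub_of_hasDerivAt (fun t _ => hderiv t)
    (hcont.intervalIntegrable _ _), one_smul, zero_smul]

end SegmentIntegral

section Potential

variable {u f : E n → ℝ}

theorem integrable_mul_inner_rieszKernel (hn : 1 < n) (hf : Integrable f) (hc : Continuous f)
    (x : E n) :
    Integrable (fun p : ℝ × E n => f p.2 * ⟪rieszKernel (p.2 - p.1 • x), x⟫_ℝ)
      ((volume.restrict (Ioc (0 : ℝ) 1)).prod volume) := by
  obtain ⟨A, hA⟩ := exists_integral_div_norm_pow_le hn hf hc ‖x‖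
  simp only [pow_one] at hA
  have hseg {t : ℝ} (ht : t ∈ Ioc (0 : ℝ) 1) : t • x ∈ closedBall (0 : E n) ‖x‖ := by
    rw [mem_closedBall_zero_iff, norm_smul, Real.norm_of_nonneg ht.1.le]
    exact mul_le_of_le_one_left (norm_nonneg _) ht.2
  have hmeas : Measurable fun p : ℝ × E n => f p.2 * ⟪rieszKernel (p.2 - p.1 • x), x⟫_ℝ :=
    (hc.measurable.comp measurable_snd).mul
      ((measurable_rieszKernel.comp (by fun_prop)).inner measurable_const)
  have hle (t : ℝ) (y : E n) :
      ‖f y * ⟪rieszKernel (y - t • x), x⟫_ℝ‖ ≤ ‖x‖ * (|f y| / ‖t • x - y‖) := by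
    rw [norm_mul, Real.norm_eq_abs, Real.norm_eq_abs, mul_div_left_comm, norm_sub_rev]
    gcongr
    exact abs_inner_rieszKernel_le _ _
  have hslice {t : ℝ} (ht : t ∈ Ioc (0 : ℝ) 1) :
      Integrable fun y => f y * ⟪rieszKernel (y - t • x), x⟫_ℝ :=
    ((hA _ (hseg ht)).1.const_mul ‖x‖).mono'
      (hmeas.comp measurable_prodMk_left).aestronglyMeasurable (ae_of_all _ (hle t))
  rw [integrable_prod_iff hmeas.aestronglyMeasurable]
  refine ⟨(ae_restrict_mem measurableSet_Ioc).mono fun t => hslice,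
    (integrable_const (‖x‖ * A)).mono' hmeas.aestronglyMeasurable.norm.integral_prod_right' ?_⟩
  filter_upwards [ae_restrict_mem measurableSet_Ioc] with t ht
  rw [Real.norm_of_nonneg (integral_nonneg fun _ => norm_nonneg _)]
  calc ∫ y, ‖f y * ⟪rieszKernel (y - t • x), x⟫_ℝ‖
      ≤ ∫ y, ‖x‖ * (|f y| / ‖t • x - y‖) :=
        integral_mono (hslice ht).norm ((hA _ (hseg ht)).1.const_mul _) (hle t)
    _ ≤ ‖x‖ * A := by
        rw [integral_const_mul]
        exact mul_le_mul_of_nonneg_left (hA _ (hseg ht)).2 (norm_nonneg _)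

theorem IsLogPotential.integrable_and_sub_eq (hn : 1 < n) (h : IsLogPotential u f) (x : E n) :
    Integrable (fun y => f y * (Real.log ‖y‖ - Real.log ‖x - y‖))
      ∧ u x - u 0 = ∫ y, f y * (Real.log ‖y‖ - Real.log ‖x - y‖) := by
  have hprod := integrable_mul_inner_rieszKernel hn h.integrable h.continuous x
  have hinner : ∀ᵐ y : E n, ∫ t in Ioc (0 : ℝ) 1, f y * ⟪rieszKernel (y - t • x), x⟫_ℝ
      = f y * (Real.log ‖y‖ - Real.log ‖x - y‖) := by
    filter_upwards [ae_forall_sub_smul_ne_zero (by simpa using hn) x] with y hy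
    rw [integral_const_mul, ← intervalIntegral.integral_of_le zero_le_one,
      intervalIntegral_inner_rieszKernel hy]
  have hgradient (t : ℝ) :
      ⟪∇ u (t • x), x⟫_ℝ = ∫ y, f y * ⟪rieszKernel (y - t • x), x⟫_ℝ := by
    rw [h.gradient_eq, real_inner_comm,
      ← integral_inner (integrable_smul_rieszKernel hn h.integrable h.continuous _)]
    simp only [inner_smul_right, real_inner_comm x]
  refine ⟨hprod.integral_prod_right.congr hinner, ?_⟩
  rw [sub_eq_intervalIntegral_inner_gradient (h.contDiff.of_le (by simp)),
    intervalIntegral.integral_of_le zero_le_one, ← integral_congr_ae hinner,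
    ← integral_integral_swap hprod]
  simp only [hgradient]

theorem integrable_mul_log_one_add_div (hn : 1 < n) (hf : Integrable f) (hc : Continuous f)
    (x : E n) : Integrable fun y => |f y| * Real.log (1 + ‖x‖ / ‖x - y‖) := by
  refine ((integrable_div_norm hn hf hc x).const_mul ‖x‖).mono' ?_ (ae_of_all _ fun y => ?_)
  · exact hf.abs.aestronglyMeasurable.mul (by fun_prop : Measurable fun y : E n =>
      Real.log (1 + ‖x‖ / ‖x - y‖)).aestronglyMeasurable
  · have hratio : 0 ≤ ‖x‖ / ‖x - y‖ := by positivity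
    have hlog : 0 ≤ Real.log (1 + ‖x‖ / ‖x - y‖) := Real.log_nonneg (by linarith)
    rw [Real.norm_of_nonneg (by positivity), mul_div_left_comm]
    gcongr
    linarith [Real.log_le_sub_one_of_pos (show 0 < 1 + ‖x‖ / ‖x - y‖ by linarith)]

theorem IsLogPotential.add_mul_log_eq (hn : 1 < n) (h : IsLogPotential u f) (x : E n) :
    u x + (∫ y, f y) * Real.log ‖x‖
      = u 0 + ∫ y, f y * (Real.log ‖y‖ - Real.log ‖x - y‖ + Real.log ‖x‖) := by
  obtain ⟨hint, heq⟩ := h.integrable_and_sub_eq hn x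
  simp only [mul_add]
  rw [integral_add hint (h.integrable.mul_const _), integral_mul_const, ← heq]
  ring

theorem IsLogPotential.exists_abs_add_mul_log_le (hn : 1 < n) (h : IsLogPotential u f) {r ε : ℝ}
    (hr : 1 ≤ r) (hε : ∫ y in {y : E n | r < ‖y‖}, |f y| ≤ ε) :
    ∃ C, ∀ x : E n, 2 * r ≤ ‖x‖ → |u x + (∫ y, f y) * Real.log ‖x‖|
      ≤ C + ε * Real.log ‖x‖
        + ∫ y in {y : E n | r < ‖y‖}, |f y| * Real.log (1 + ‖x‖ / ‖x - y‖) := by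
  set T := {y : E n | r < ‖y‖}
  have hf := h.integrable
  have hT : MeasurableSet T := measurableSet_lt measurable_const measurable_norm
  have hnear : Integrable fun y => |f y| * (r + 1 + ‖y‖⁻¹) := by
    refine ((hf.abs.mul_const (r + 1)).add
      (integrable_div_norm hn hf h.continuous 0)).congr (ae_of_all _ fun y => ?_)
    simp only [Pi.add_apply, zero_sub, norm_neg]
    ring
  refine ⟨|u 0| + ∫ y, |f y| * (r + 1 + ‖y‖⁻¹), fun x hx => ?_⟩
  have hratio := integrable_mul_log_one_add_div hn hf h.continuous x
  have hfar : Integrable (T.indicator fun y =>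
      |f y| * Real.log ‖x‖ + |f y| * Real.log (1 + ‖x‖ / ‖x - y‖)) :=
    ((hf.abs.mul_const _).add hratio).indicator hT
  have hbound : |∫ y, f y * (Real.log ‖y‖ - Real.log ‖x - y‖ + Real.log ‖x‖)|
      ≤ ∫ y, (|f y| * (r + 1 + ‖y‖⁻¹) + T.indicator (fun y =>
          |f y| * Real.log ‖x‖ + |f y| * Real.log (1 + ‖x‖ / ‖x - y‖)) y) := by
    rw [← Real.norm_eq_abs]
    refine norm_integral_le_of_norm_le (hnear.add hfar) ?_
    filter_upwards [ae_forall_sub_smul_ne_zero (by simpa using hn) x] with y hy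
    have hy0 : y ≠ 0 := by simpa using hy 0
    have hxy : x ≠ y := fun heq => by simpa [heq] using hy 1
    have hkernel := mul_le_mul_of_nonneg_left
      (abs_log_norm_add_log_norm_sub_log_norm_sub_le_indicator hr hx hy0 hxy) (abs_nonneg (f y))
    rw [mul_add, ← abs_mul, ← indicator_mul_right _ fun y => |f y|] at hkernel
    exact hkernel.trans_eq (by simp only [mul_add, T])
  rw [integral_add hnear hfar, integral_indicator hT,
    integral_add (hf.abs.mul_const _).integrableOn hratio.integrableOn,
    integral_mul_const] at hbound
  have hlog : 0 ≤ Real.log ‖x‖ := Real.log_nonneg (by linarith)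
  rw [h.add_mul_log_eq hn]
  linarith [abs_add_le (u 0) (∫ y, f y * (Real.log ‖y‖ - Real.log ‖x - y‖ + Real.log ‖x‖)),
    mul_le_mul_of_nonneg_right hε hlog]

end Potential

section ExponentialIntegral

variable {X : Type*} [MeasurableSpace X] {ν : Measure X} {q : X → ℝ} {c : ℝ}

theorem integrable_log_one_add (hq : Integrable q ν) (hq0 : ∀ y, 0 ≤ q y) :
    Integrable (fun y => Real.log (1 + q y)) ν := by
  refine hq.mono' (hq.aemeasurable.const_add 1).log.aestronglyMeasurable (ae_of_all _ fun y => ?_)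
  have hqy := hq0 y
  rw [Real.norm_of_nonneg (Real.log_nonneg (by linarith))]
  linarith [Real.log_le_sub_one_of_pos (show 0 < 1 + q y by linarith)]

theorem mul_integral_log_one_add_le [IsFiniteMeasure ν] (hc : 0 ≤ c)
    (hν : c * ν.real univ ≤ 1) (hq : Integrable q ν) (hq0 : ∀ y, 0 ≤ q y) :
    c * ∫ y, Real.log (1 + q y) ∂ν ≤ Real.log (1 + c * ∫ y, q y ∂ν) := by
  set s := 1 + c * ∫ y, q y ∂ν with hs
  have hs0 : 0 < s := add_pos_of_pos_of_nonneg one_pos (mul_nonneg hc (integral_nonneg hq0))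
  have htangent (y : X) : Real.log (1 + q y) ≤ (Real.log s - 1 + s⁻¹) + s⁻¹ * q y := by
    have hqy := hq0 y
    have hle := Real.log_le_sub_one_of_pos (show 0 < (1 + q y) / s by positivity)
    rw [Real.log_div (by linarith) hs0.ne', add_div, one_div, div_eq_inv_mul] at hle
    linarith
  have hconst : 0 ≤ Real.log s - 1 + s⁻¹ := by linarith [Real.one_sub_inv_le_log_of_pos hs0]
  calc c * ∫ y, Real.log (1 + q y) ∂ν
      ≤ c * ∫ y, (Real.log s - 1 + s⁻¹) + s⁻¹ * q y ∂ν :=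
        mul_le_mul_of_nonneg_left (integral_mono (integrable_log_one_add hq hq0)
          ((integrable_const _).add (hq.const_mul _)) htangent) hc
    _ = c * ν.real univ * (Real.log s - 1 + s⁻¹) + s⁻¹ * (s - 1) := by
        rw [integral_add (integrable_const _) (hq.const_mul _), integral_const,
          integral_const_mul, smul_eq_mul, hs]
        ring
    _ ≤ (Real.log s - 1 + s⁻¹) + s⁻¹ * (s - 1) := by
        gcongr
        exact mul_le_of_le_one_left hconst hν
    _ = Real.log s := by
        field_simp
        ring

theorem ofReal_exp_mul_integral_log_one_add_le [IsFiniteMeasure ν] (hc : 0 < c)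
    (hν : c * ν.real univ ≤ 1) (hq : Measurable q) (hq0 : ∀ y, 0 ≤ q y) :
    ENNReal.ofReal (Real.exp (c * ∫ y, Real.log (1 + q y) ∂ν))
      ≤ 1 + ENNReal.ofReal c * ∫⁻ y, ENNReal.ofReal (q y) ∂ν := by
  rcases eq_or_ne (∫⁻ y, ENNReal.ofReal (q y) ∂ν) ⊤ with htop | htop
  · simp [htop, hc]
  have hqi : Integrable q ν :=
    ⟨hq.aestronglyMeasurable, (hasFiniteIntegral_iff_ofReal (ae_of_all _ hq0)).2 htop.lt_top⟩
  have hQ : 0 ≤ c * ∫ y, q y ∂ν := mul_nonneg hc.le (integral_nonneg hq0)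
  rw [← ofReal_integral_eq_lintegral_ofReal hqi (ae_of_all _ hq0), ← ENNReal.ofReal_mul hc.le,
    ← ENNReal.ofReal_one, ← ENNReal.ofReal_add zero_le_one hQ]
  exact ENNReal.ofReal_le_ofReal ((Real.le_log_iff_exp_le (by linarith)).1
    (mul_integral_log_one_add_le hc.le hν hqi hq0))

end ExponentialIntegral

section Dilations

theorem tendsto_setIntegral_norm_gt {V F : Type*} [NormedAddCommGroup V] [MeasurableSpace V]
    [OpensMeasurableSpace V] {μ : Measure V} [NormedAddCommGroup F] [NormedSpace ℝ F] {g : V → F}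
    (hg : Integrable g μ) :
    Tendsto (fun r : ℝ => ∫ y in {y : V | r < ‖y‖}, g y ∂μ) atTop (𝓝 0) := by
  have hempty : ⋂ r : ℝ, {y : V | r < ‖y‖} = ∅ :=
    eq_empty_of_forall_notMem fun y hy => lt_irrefl ‖y‖ (mem_iInter.1 hy ‖y‖)
  have hanti : Antitone fun r : ℝ => {y : V | r < ‖y‖} := fun r s hrs y (hy : s < ‖y‖) =>
    hrs.trans_lt hy
  simpa [hempty] using tendsto_setIntegral_of_antitone
    (fun _ => measurableSet_lt measurable_const measurable_norm) hanti ⟨0, hg.integrableOn⟩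

theorem eventually_forall_smul {V : Type*} [NormedAddCommGroup V] [NormedSpace ℝ V] {p : V → Prop}
    (hp : ∀ᶠ x in cocompact V, p x) {B : Set V} (hB : IsClosed B) (h0 : 0 ∉ B) :
    ∀ᶠ R : ℝ in atTop, ∀ x ∈ B, p (R • x) := by
  obtain ⟨K, hK, hKp⟩ := mem_cocompact.1 hp
  obtain ⟨ρ, hρ, hKρ⟩ := hK.isBounded.exists_pos_norm_le
  obtain ⟨d, hd, hBd⟩ := Metric.mem_nhds_iff.1 (hB.isOpen_compl.mem_nhds h0)
  filter_upwards [eventually_gt_atTop (ρ / d)] with R hR x hx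
  refine hKp fun hxK => ?_
  have hdx : d ≤ ‖x‖ := not_lt.1 fun hlt => hBd (mem_ball_zero_iff.2 hlt) hx
  have hR0 : 0 < R := (by positivity : 0 < ρ / d).trans hR
  have hle := hKρ _ hxK
  rw [norm_smul, Real.norm_of_nonneg hR0.le] at hle
  rw [div_lt_iff₀ hd] at hR
  exact hle.not_gt (hR.trans_le (by gcongr))

theorem setIntegral_mono_of_isCompact {X : Type*} [TopologicalSpace X] [T2Space X]
    [MeasurableSpace X] [OpensMeasurableSpace X] {μ : Measure X} [IsFiniteMeasureOnCompacts μ]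
    {B : Set X} (hB : IsCompact B) {f g : X → ℝ} (hf : Continuous f) (hg : Continuous g)
    (h : ∀ x ∈ B, f x ≤ g x) : ∫ x in B, f x ∂μ ≤ ∫ x in B, g x ∂μ :=
  setIntegral_mono_on (hf.continuousOn.integrableOn_compact hB)
    (hg.continuousOn.integrableOn_compact hB) hB.measurableSet h

variable {B : Set (E n)}

theorem exists_setLIntegral_norm_smul_div_le (hn : 1 < n) (hB : IsCompact B) : ∃ A : ℝ, 0 ≤ A ∧
    ∀ R : ℝ, R ≠ 0 → ∀ y : E n,
      ∫⁻ x in B, ENNReal.ofReal (‖R • x‖ / ‖R • x - y‖) ≤ ENNReal.ofReal A := by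
  obtain ⟨A, hA0, hA⟩ :=
    exists_setLIntegral_inv_norm_sub_pow_le hn hB.measurableSet hB.measure_lt_top.ne
  simp only [pow_one] at hA
  obtain ⟨ρ, hρ0, hρ⟩ := hB.isBounded.exists_pos_norm_le
  refine ⟨ρ * A, by positivity, fun R hR y => ?_⟩
  have hscale (x : E n) : ‖R • x‖ / ‖R • x - y‖ = ‖x‖ * ‖x - R⁻¹ • y‖⁻¹ := by
    rw [← smul_inv_smul₀ hR y, ← smul_sub, norm_smul, norm_smul, inv_smul_smul₀ hR,
      mul_div_mul_left _ _ (norm_ne_zero_iff.2 hR), div_eq_mul_inv]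
  calc ∫⁻ x in B, ENNReal.ofReal (‖R • x‖ / ‖R • x - y‖)
      ≤ ∫⁻ x in B, ENNReal.ofReal ρ * ENNReal.ofReal (‖x - R⁻¹ • y‖⁻¹) := by
        refine setLIntegral_mono (by fun_prop) fun x hx => ?_
        rw [hscale, ← ENNReal.ofReal_mul hρ0.le]
        gcongr
        exact hρ x hx
    _ = ENNReal.ofReal ρ * ∫⁻ x in B, ENNReal.ofReal (‖x - R⁻¹ • y‖⁻¹) :=
        lintegral_const_mul _ (by fun_prop)
    _ ≤ ENNReal.ofReal ρ * ENNReal.ofReal A := by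
        gcongr
        exact hA _
    _ = ENNReal.ofReal (ρ * A) := (ENNReal.ofReal_mul hρ0.le).symm

theorem exists_setLIntegral_exp_integral_log_le (hn : 1 < n) (hB : IsCompact B) {c : ℝ}
    (hc : 0 < c) : ∃ A : ℝ, 0 ≤ A ∧ ∀ (ν : Measure (E n)) [IsFiniteMeasure ν],
      c * ν.real univ ≤ 1 → ∀ R : ℝ, R ≠ 0 → ∫⁻ x in B, ENNReal.ofReal
        (Real.exp (c * ∫ y, Real.log (1 + ‖R • x‖ / ‖R • x - y‖) ∂ν)) ≤ ENNReal.ofReal A := by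
  obtain ⟨A, hA0, hA⟩ := exists_setLIntegral_norm_smul_div_le hn hB
  refine ⟨volume.real B + A, by positivity, fun ν _ hν R hR => ?_⟩
  have hm : Measurable fun p : E n × E n =>
      ENNReal.ofReal (‖R • p.1‖ / ‖R • p.1 - p.2‖) := by fun_prop
  calc ∫⁻ x in B, ENNReal.ofReal
        (Real.exp (c * ∫ y, Real.log (1 + ‖R • x‖ / ‖R • x - y‖) ∂ν))
      ≤ ∫⁻ x in B, (1 + ENNReal.ofReal c
          * ∫⁻ y, ENNReal.ofReal (‖R • x‖ / ‖R • x - y‖) ∂ν) := by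
        refine lintegral_mono fun x => ?_
        exact ofReal_exp_mul_integral_log_one_add_le hc hν (by fun_prop) fun y => by positivity
    _ = volume B + ENNReal.ofReal c
          * ∫⁻ y, (∫⁻ x in B, ENNReal.ofReal (‖R • x‖ / ‖R • x - y‖)) ∂ν := by
        rw [lintegral_add_left measurable_const, lintegral_const_mul _ hm.lintegral_prod_right',
          lintegral_lintegral_swap hm.aemeasurable, lintegral_const, one_mul,
          Measure.restrict_apply_univ]
    _ ≤ volume B + ENNReal.ofReal c * (ENNReal.ofReal A * ν univ) := by
        rw [← lintegral_const]
        gcongr with y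
        exact hA R hR y
    _ = volume B + ENNReal.ofReal (c * ν.real univ) * ENNReal.ofReal A := by
        rw [ENNReal.ofReal_mul hc.le, ofReal_measureReal]
        ring
    _ ≤ volume B + 1 * ENNReal.ofReal A := by
        gcongr
        exact ENNReal.ofReal_le_one.2 hν
    _ = ENNReal.ofReal (volume.real B + A) := by
        rw [ENNReal.ofReal_add measureReal_nonneg hA0, one_mul,
          ofReal_measureReal hB.measure_lt_top.ne]

variable {u f : E n → ℝ}

theorem IsLogPotential.exists_abs_smul_add_mul_log_le (hn : 1 < n) (h : IsLogPotential u f)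
    {r ε : ℝ} (hr : 1 ≤ r) (hε : ∫ y in {y : E n | r < ‖y‖}, |f y| ≤ ε) (hB : IsCompact B)
    (h0 : 0 ∉ B) :
    ∃ C, ∀ᶠ R : ℝ in atTop, ∀ x ∈ B, |u (R • x) + (∫ y, f y) * Real.log R|
      ≤ C + ε * Real.log R
        + ∫ y in {y : E n | r < ‖y‖}, |f y| * Real.log (1 + ‖R • x‖ / ‖R • x - y‖) := by
  obtain ⟨C, hC⟩ := h.exists_abs_add_mul_log_le hn hr hε
  have hB0 : ∀ x ∈ B, ‖x‖ ≠ 0 := fun x hx => norm_ne_zero_iff.2 (ne_of_mem_of_not_mem hx h0)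
  obtain ⟨L, hL⟩ := hB.exists_bound_of_continuousOn (f := fun x => Real.log ‖x‖)
    (continuous_norm.continuousOn.log hB0)
  have hε0 : 0 ≤ ε := (integral_nonneg fun _ => abs_nonneg _).trans hε
  refine ⟨C + ε * L + |∫ y, f y| * L, ?_⟩
  have hfar : ∀ᶠ x in cocompact (E n), 2 * r ≤ ‖x‖ :=
    tendsto_norm_cocompact_atTop.eventually_ge_atTop (2 * r)
  filter_upwards [eventually_gt_atTop 0, eventually_forall_smul hfar hB.isClosed h0]
    with R hR hRB x hx
  have hlog : Real.log ‖R • x‖ = Real.log R + Real.log ‖x‖ := by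
    rw [norm_smul, Real.norm_of_nonneg hR.le, Real.log_mul hR.ne' (hB0 x hx)]
  have hLx : |Real.log ‖x‖| ≤ L := hL x hx
  have hbound := hC (R • x) (hRB x hx)
  rw [hlog] at hbound
  have htotal : |(∫ y, f y) * Real.log ‖x‖| ≤ |∫ y, f y| * L := by
    rw [abs_mul]
    gcongr
  have hεL : ε * Real.log ‖x‖ ≤ ε * L := by
    gcongr
    exact (le_abs_self _).trans hLx
  have habs := abs_sub (u (R • x) + (∫ y, f y) * (Real.log R + Real.log ‖x‖))
    ((∫ y, f y) * Real.log ‖x‖)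
  rw [mul_add, ← add_assoc, add_sub_cancel_right] at habs
  rw [mul_add, mul_add, ← add_assoc] at hbound
  linarith

theorem setIntegral_absMeasure (hf : Continuous f) (g : E n → ℝ) {T : Set (E n)}
    (hT : MeasurableSet T) : ∫ y in T, g y ∂absMeasure f = ∫ y in T, |f y| * g y :=
  setIntegral_withDensity_eq_setIntegral_smul hf.nnnorm.measurable g hT

theorem setIntegral_le_mul_of_setLIntegral_le {X : Type*} [MeasurableSpace X] {μ : Measure X}
    {B : Set X} (hB : MeasurableSet B) {F G : X → ℝ} {K A : ℝ} (hK : 0 ≤ K) (hA : 0 ≤ A)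
    (hF : AEStronglyMeasurable F (μ.restrict B)) (hF0 : ∀ x, 0 ≤ F x)
    (hFG : ∀ x ∈ B, F x ≤ K * G x)
    (hG : ∫⁻ x in B, ENNReal.ofReal (G x) ∂μ ≤ ENNReal.ofReal A) :
    ∫ x in B, F x ∂μ ≤ K * A := by
  rw [integral_eq_lintegral_of_nonneg_ae (ae_of_all _ hF0) hF]
  refine ENNReal.toReal_le_of_le_ofReal (mul_nonneg hK hA) ?_
  calc ∫⁻ x in B, ENNReal.ofReal (F x) ∂μ
      ≤ ∫⁻ x in B, ENNReal.ofReal K * ENNReal.ofReal (G x) ∂μ := by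
        refine setLIntegral_mono' hB fun x hx => ?_
        rw [← ENNReal.ofReal_mul hK]
        exact ENNReal.ofReal_le_ofReal (hFG x hx)
    _ ≤ ENNReal.ofReal K * ENNReal.ofReal A := by
        rw [lintegral_const_mul' _ _ ENNReal.ofReal_ne_top]
        gcongr
    _ = ENNReal.ofReal (K * A) := (ENNReal.ofReal_mul hK).symm

/- Outside a large ball `f` has mass at most `min (δ / 2) (1 / 2)`: the bound `1 / 2` makes the
exponential of the potential of the tail integrable, `δ / 2` keeps the growth below `R ^ δ`. -/
theorem IsLogPotential.exists_setIntegral_exp_abs_le (hn : 1 < n) (h : IsLogPotential u f)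
    (hB : IsCompact B) (h0 : 0 ∉ B) {δ : ℝ} (hδ : 0 < δ) :
    ∃ C : ℝ, 0 < C ∧ ∀ᶠ R : ℝ in atTop,
      ∫ x in B, Real.exp (2 * |u (R • x) + (∫ y, f y) * Real.log R|) ≤ C * R ^ δ := by
  set ε := min (δ / 2) (1 / 2)
  have hε0 : 0 < ε := by positivity
  obtain ⟨r, hr1, hr⟩ : ∃ r : ℝ, 1 ≤ r ∧ ∫ y in {y : E n | r < ‖y‖}, |f y| ≤ ε :=
    ((eventually_ge_atTop 1).and ((tendsto_setIntegral_norm_gt h.integrable.abs).eventually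
      (Iic_mem_nhds hε0))).exists
  obtain ⟨C, hC⟩ := h.exists_abs_smul_add_mul_log_le hn hr1 hr hB h0
  obtain ⟨A, hA0, hA⟩ := exists_setLIntegral_exp_integral_log_le hn hB two_pos
  set T := {y : E n | r < ‖y‖}
  have hT : MeasurableSet T := measurableSet_lt measurable_const measurable_norm
  have := isFiniteMeasure_absMeasure h.integrable
  have hmass : 2 * ((absMeasure f).restrict T).real univ ≤ 1 := by
    have hreal := setIntegral_absMeasure h.continuous (fun _ => (1 : ℝ)) hT
    simp only [integral_const, mul_one, smul_eq_mul] at hreal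
    linarith [min_le_right (δ / 2) (1 / 2 : ℝ)]
  refine ⟨Real.exp (2 * C) * (A + 1), by positivity, ?_⟩
  filter_upwards [hC, eventually_ge_atTop 1] with R hRB hR1
  have hR0 : 0 < R := by linarith
  have hlog : 2 * ε * Real.log R ≤ δ * Real.log R :=
    mul_le_mul_of_nonneg_right (by linarith [min_le_left (δ / 2) (1 / 2 : ℝ)])
      (Real.log_nonneg hR1)
  have hcont : Continuous fun x : E n => Real.exp (2 * |u (R • x) + (∫ y, f y) * Real.log R|) := by
    have := h.contDiff.continuous
    fun_prop
  calc ∫ x in B, Real.exp (2 * |u (R • x) + (∫ y, f y) * Real.log R|)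
      ≤ Real.exp (2 * C) * R ^ δ * A := by
        refine setIntegral_le_mul_of_setLIntegral_le hB.measurableSet (by positivity) hA0
          hcont.aestronglyMeasurable (fun x => (Real.exp_pos _).le) (fun x hx => ?_)
          (hA _ hmass R hR0.ne')
        have hle := hRB x hx
        rw [← setIntegral_absMeasure h.continuous _ hT] at hle
        rw [Real.rpow_def_of_pos hR0, ← Real.exp_add, ← Real.exp_add]
        gcongr
        linarith
    _ ≤ Real.exp (2 * C) * (A + 1) * R ^ δ := by
        rw [mul_right_comm]
        gcongr
        linarith

end Dilations

section Quantization

variable {u f φ : E n → ℝ} {B : Set (E n)}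

theorem exists_bump_zero_notMem_tsupport (hn : 0 < n) :
    ∃ φ : E n → ℝ, ContDiff ℝ ∞ φ ∧ HasCompactSupport φ ∧ 0 ∉ tsupport φ ∧ (∀ x, 0 ≤ φ x) ∧
      (∀ x, φ x ≤ 1) ∧ 0 < volume.real (tsupport φ) ∧ 0 < ∫ x, φ x * (‖x‖ ^ 2)⁻¹ := by
  obtain ⟨c, hc⟩ : ∃ c : E n, ‖c‖ = 2 := ⟨EuclideanSpace.single ⟨0, hn⟩ 2, by simp⟩
  let φ : ContDiffBump c := ⟨1 / 2, 1, by norm_num, by norm_num⟩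
  have hsupp : tsupport φ = closedBall c 1 := φ.tsupport_eq
  have h0 : 0 ∉ tsupport φ := by
    rw [hsupp, mem_closedBall, dist_zero_left, hc]
    norm_num
  have hcont : Continuous fun x : E n => φ x * (‖x‖ ^ 2)⁻¹ :=
    continuous_of_tsupport fun x hx => by
      have hx0 : ‖x‖ ^ 2 ≠ 0 := pow_ne_zero 2 (norm_ne_zero_iff.2
        (ne_of_mem_of_not_mem (tsupport_mul_subset_left hx) h0))
      exact φ.continuous.continuousAt.mul (ContinuousAt.inv₀ (by fun_prop) hx0)
  have hvol : 0 < volume.real (tsupport φ) := by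
    rw [hsupp]
    exact ENNReal.toReal_pos (measure_closedBall_pos volume c one_pos).ne'
      measure_closedBall_lt_top.ne
  refine ⟨φ, φ.contDiff, φ.hasCompactSupport, h0, fun x => φ.nonneg, fun x => φ.le_one, hvol, ?_⟩
  refine hcont.integral_pos_of_hasCompactSupport_nonneg_nonzero (x := c)
    φ.hasCompactSupport.mul_right (fun x => mul_nonneg φ.nonneg (by positivity)) ?_
  rw [φ.one_of_mem_closedBall (mem_closedBall_self φ.rIn_pos.le), hc]
  norm_num

theorem IsLogPotential.total_mem_Icc (hn : 2 < n) (h : IsLogPotential u f)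
    (hS : ∀ᶠ x in cocompact (E n), 0 ≤ scalarDensity u x) : ∫ y, f y ∈ Icc (0 : ℝ) 2 := by
  obtain ⟨φ, hφ, hc, h0, hφ0, -, -, hI⟩ := exists_bump_zero_notMem_tsupport (by omega : 0 < n)
  have hn' : (0 : ℝ) < n - 2 := sub_pos.2 (by exact_mod_cast hn)
  have hlim : 0 ≤ ((n : ℝ) - 2) * ((∫ y, f y) - (∫ y, f y) ^ 2 / 2) *
      ∫ x, φ x * (‖x‖ ^ 2)⁻¹ := by
    refine ge_of_tendsto (h.tendsto_integral_mul_scalarDensity hφ hc hn h0) ?_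
    filter_upwards [eventually_forall_smul hS (isClosed_tsupport φ) h0] with R hR
    refine integral_nonneg fun x => ?_
    by_cases hx : x ∈ tsupport φ
    · exact mul_nonneg (hφ0 x) (mul_nonneg (sq_nonneg R) (hR x hx))
    · simp [image_eq_zero_of_notMem_tsupport hx]
  have hquad : 0 ≤ (∫ y, f y) - (∫ y, f y) ^ 2 / 2 :=
    nonneg_of_mul_nonneg_right (nonneg_of_mul_nonneg_left hlim hI) hn'
  constructor <;> nlinarith

theorem IsLogPotential.exists_le_setIntegral_exp_of_total_mem_Ioo (hn : 2 < n)
    (h : IsLogPotential u f) {C : ℝ}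
    (hS : ∀ᶠ x in cocompact (E n), scalarDensity u x ≤ C * Real.exp (2 * u x))
    (hφ : ContDiff ℝ ∞ φ) (hc : HasCompactSupport φ) (h0 : 0 ∉ tsupport φ) (hφ0 : ∀ x, 0 ≤ φ x)
    (hφ1 : ∀ x, φ x ≤ 1) (hI : 0 < ∫ x, φ x * (‖x‖ ^ 2)⁻¹) (hα : ∫ y, f y ∈ Ioo (0 : ℝ) 2) :
    ∃ c : ℝ, 0 < c ∧
      ∀ᶠ R : ℝ in atTop, c ≤ ∫ x in tsupport φ, R ^ 2 * Real.exp (2 * u (R • x)) := by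
  have hn' : (0 : ℝ) < n - 2 := sub_pos.2 (by exact_mod_cast hn)
  have hlim := h.tendsto_integral_mul_scalarDensity hφ hc hn h0
  set L := ((n : ℝ) - 2) * ((∫ y, f y) - (∫ y, f y) ^ 2 / 2) * ∫ x, φ x * (‖x‖ ^ 2)⁻¹
  have hL : 0 < L := mul_pos (mul_pos hn' (by nlinarith [hα.1, hα.2])) hI
  have hM : 0 < max C 1 := lt_max_of_lt_right one_pos
  refine ⟨L / 2 / max C 1, by positivity, ?_⟩
  filter_upwards [hlim.eventually (lt_mem_nhds (half_lt_self hL)),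
    eventually_forall_smul hS (isClosed_tsupport φ) h0] with R hLR hSR
  have hdensity : Continuous fun x : E n => scalarDensity u (R • x) :=
    (continuous_scalarDensity h.contDiff).comp (continuous_const_smul R)
  have hexp : Continuous fun x : E n => Real.exp (2 * u (R • x)) := by
    have := h.contDiff.continuous
    fun_prop
  rw [div_le_iff₀ hM, mul_comm, ← integral_const_mul]
  refine hLR.le.trans ?_
  rw [← setIntegral_eq_integral_of_forall_compl_eq_zero (s := tsupport φ) fun x hx => by
    rw [image_eq_zero_of_notMem_tsupport hx, zero_mul]]
  refine setIntegral_mono_of_isCompact hc (hφ.continuous.mul (continuous_const.mul hdensity))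
    (by fun_prop) fun x hx => ?_
  calc φ x * (R ^ 2 * scalarDensity u (R • x))
      ≤ φ x * (R ^ 2 * (max C 1 * Real.exp (2 * u (R • x)))) := by
        have hle := (hSR x hx).trans
          (mul_le_mul_of_nonneg_right (le_max_left C 1) (Real.exp_pos _).le)
        exact mul_le_mul_of_nonneg_left (mul_le_mul_of_nonneg_left hle (sq_nonneg R)) (hφ0 x)
    _ ≤ 1 * (R ^ 2 * (max C 1 * Real.exp (2 * u (R • x)))) :=
        mul_le_mul_of_nonneg_right (hφ1 x) (by positivity)
    _ = max C 1 * (R ^ 2 * Real.exp (2 * u (R • x))) := by ring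

theorem two_mul_sub_sq_mul_exp_le (s w : ℝ) :
    2 * s - s ^ 2 * Real.exp (2 * |w|) ≤ Real.exp (2 * w) := by
  have hinv : Real.exp (-(2 * w)) * Real.exp (2 * w) = 1 := by rw [← Real.exp_add]; simp
  have hle : s ^ 2 * Real.exp (-(2 * w)) ≤ s ^ 2 * Real.exp (2 * |w|) := by
    gcongr
    linarith [neg_abs_le w]
  have hsq : 0 ≤ (s * Real.exp (-(2 * w)) - 1) ^ 2 * Real.exp (2 * w) := by positivity
  linear_combination hle + hsq + (s ^ 2 * Real.exp (-(2 * w)) - 2 * s) * hinv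

theorem sq_measureReal_div_le_setIntegral_exp {X : Type*} [TopologicalSpace X] [T2Space X]
    [MeasurableSpace X] [OpensMeasurableSpace X] {μ : Measure X} [IsFiniteMeasureOnCompacts μ]
    {B : Set X} (hB : IsCompact B) {v : X → ℝ} (hv : Continuous v) {D : ℝ} (hD : 0 < D)
    (h : ∫ x in B, Real.exp (2 * |v x|) ∂μ ≤ D) :
    μ.real B ^ 2 / D ≤ ∫ x in B, Real.exp (2 * v x) ∂μ := by
  set s := μ.real B / D with hs
  have hconst : IntegrableOn (fun _ => 2 * s) B μ := integrableOn_const hB.measure_lt_top.ne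
  have hexp : Continuous fun x => s ^ 2 * Real.exp (2 * |v x|) := by fun_prop
  calc μ.real B ^ 2 / D = μ.real B * (2 * s) - s ^ 2 * D := by
        rw [hs]
        field_simp
        ring
    _ ≤ μ.real B * (2 * s) - s ^ 2 * ∫ x in B, Real.exp (2 * |v x|) ∂μ := by gcongr
    _ = ∫ x in B, 2 * s - s ^ 2 * Real.exp (2 * |v x|) ∂μ := by
        rw [integral_sub hconst (hexp.continuousOn.integrableOn_compact hB), setIntegral_const,
          integral_const_mul, smul_eq_mul]
    _ ≤ ∫ x in B, Real.exp (2 * v x) ∂μ :=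
        setIntegral_mono_of_isCompact hB (by fun_prop) (by fun_prop)
          fun x _ => two_mul_sub_sq_mul_exp_le s (v x)

theorem IsLogPotential.exists_le_setIntegral_exp_of_total_eq_zero (hn : 1 < n)
    (h : IsLogPotential u f) (hB : IsCompact B) (h0 : 0 ∉ B) (hvol : 0 < volume.real B)
    (hα : ∫ y, f y = 0) : ∃ c : ℝ, 0 < c ∧
      ∀ᶠ R : ℝ in atTop, c ≤ ∫ x in B, R ^ 2 * Real.exp (2 * u (R • x)) := by
  obtain ⟨C, hC0, hC⟩ := h.exists_setIntegral_exp_abs_le hn hB h0 one_pos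
  simp only [hα, zero_mul, add_zero, Real.rpow_one] at hC
  refine ⟨volume.real B ^ 2 / C, by positivity, ?_⟩
  filter_upwards [hC, eventually_ge_atTop 1] with R hR hR1
  have : 0 < R := by linarith
  rw [integral_const_mul]
  calc volume.real B ^ 2 / C ≤ R * (volume.real B ^ 2 / C) :=
        le_mul_of_one_le_left (by positivity) hR1
    _ = R ^ 2 * (volume.real B ^ 2 / (C * R)) := by field_simp
    _ ≤ R ^ 2 * ∫ x in B, Real.exp (2 * u (R • x)) := by
        gcongr
        exact sq_measureReal_div_le_setIntegral_exp hB
          (h.contDiff.continuous.comp (continuous_const_smul R)) (by positivity) hR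

theorem IsLogPotential.tendsto_setIntegral_exp (hn : 1 < n) (h : IsLogPotential u f)
    (hB : IsCompact B) (h0 : 0 ∉ B) (hα : 1 < ∫ y, f y) :
    Tendsto (fun R : ℝ => ∫ x in B, R ^ 2 * Real.exp (2 * u (R • x))) atTop (𝓝 0) := by
  have hδ : 0 < (∫ y, f y) - 1 := by linarith
  obtain ⟨C, -, hC⟩ := h.exists_setIntegral_exp_abs_le hn hB h0 hδ
  set α := ∫ y, f y
  have hlim : Tendsto (fun R : ℝ => C * R ^ (-(α - 1))) atTop (𝓝 0) := by
    simpa using (tendsto_rpow_neg_atTop hδ).const_mul C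
  refine squeeze_zero' (Eventually.of_forall fun R => by positivity) ?_ hlim
  filter_upwards [hC, eventually_gt_atTop 0] with R hR hR0
  have hu := h.contDiff.continuous
  calc ∫ x in B, R ^ 2 * Real.exp (2 * u (R • x))
      ≤ ∫ x in B, R ^ (2 - 2 * α) * Real.exp (2 * |u (R • x) + α * Real.log R|) := by
        refine setIntegral_mono_of_isCompact hB (by fun_prop) (by fun_prop) fun x _ => ?_
        rw [← Real.rpow_natCast, Real.rpow_def_of_pos hR0, Real.rpow_def_of_pos hR0,
          ← Real.exp_add, ← Real.exp_add]
        refine Real.exp_le_exp.2 ?_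
        push_cast
        linarith [le_abs_self (u (R • x) + α * Real.log R)]
    _ ≤ R ^ (2 - 2 * α) * (C * R ^ (α - 1)) := by
        rw [integral_const_mul]
        gcongr
    _ = C * R ^ (-(α - 1)) := by
        rw [mul_left_comm, ← Real.rpow_add hR0]
        ring_nf

theorem pow_mul_sub_le_pow_succ {s η : ℝ} (hs : 0 ≤ s) (hη : 0 ≤ η) (j : ℕ) :
    η ^ j * (s - η) ≤ s ^ (j + 1) := by
  rcases le_total s η with h | h
  · exact (mul_nonpos_of_nonneg_of_nonpos (by positivity) (by linarith)).trans (by positivity)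
  · rw [pow_succ]
    gcongr
    linarith

open scoped Pointwise in
theorem setIntegral_smul_exp_eq {m : ℕ} (hn : n = 2 * m) (u : E n → ℝ) (B : Set (E n)) {R : ℝ}
    (hR : 0 < R) :
    ∫ y in R • B, Real.exp (n * u y) = ∫ x in B, (R ^ 2 * Real.exp (2 * u (R • x))) ^ m := by
  have hn' : (n : ℝ) = 2 * m := by exact_mod_cast hn
  have hscale :=
    Measure.setIntegral_comp_smul_of_pos volume (fun y : E n => Real.exp (n * u y)) B hR
  rw [finrank_euclideanSpace_fin, smul_eq_mul, eq_inv_mul_iff_mul_eq₀ (by positivity),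
    ← integral_const_mul] at hscale
  rw [← hscale]
  congr with x
  rw [mul_pow, ← pow_mul, ← Real.exp_nat_mul, ← hn, hn']
  ring_nf

open scoped Pointwise in
theorem not_integrable_exp_of_le_setIntegral {j : ℕ} (hn : n = 2 * (j + 1)) (hu : Continuous u)
    (hB : IsCompact B) (h0 : 0 ∉ B) {c : ℝ} (hc : 0 < c)
    (h : ∀ᶠ R : ℝ in atTop, c ≤ ∫ x in B, R ^ 2 * Real.exp (2 * u (R • x))) :
    ¬ Integrable fun x => Real.exp (n * u x) := by
  intro hi
  set η := c / (2 * (volume.real B + 1)) with hη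
  have hη0 : 0 < η := by positivity
  have hηB : volume.real B * η ≤ c / 2 := by
    rw [hη, mul_div_assoc', div_le_div_iff₀ (by positivity) two_pos]
    nlinarith
  obtain ⟨r, hr⟩ := ((tendsto_setIntegral_norm_gt hi).eventually
    (gt_mem_nhds (by positivity : 0 < η ^ j * (c / 2)))).exists
  have hfar : ∀ᶠ x in cocompact (E n), r < ‖x‖ :=
    tendsto_norm_cocompact_atTop.eventually_gt_atTop r
  obtain ⟨R, ⟨hR, hR0⟩, hRB⟩ := ((h.and (eventually_gt_atTop 0)).and
    (eventually_forall_smul hfar hB.isClosed h0)).exists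
  have hcont : Continuous fun x : E n => R ^ 2 * Real.exp (2 * u (R • x)) := by fun_prop
  have hconst : IntegrableOn (fun _ : E n => η) B := integrableOn_const hB.measure_lt_top.ne
  refine hr.not_ge ?_
  calc η ^ j * (c / 2)
      ≤ η ^ j * ((∫ x in B, R ^ 2 * Real.exp (2 * u (R • x))) - volume.real B * η) := by
        gcongr
        linarith
    _ = ∫ x in B, η ^ j * (R ^ 2 * Real.exp (2 * u (R • x)) - η) := by
        rw [integral_const_mul (η ^ j),
          integral_sub (hcont.continuousOn.integrableOn_compact hB) hconst, setIntegral_const,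
          smul_eq_mul]
    _ ≤ ∫ x in B, (R ^ 2 * Real.exp (2 * u (R • x))) ^ (j + 1) :=
        setIntegral_mono_of_isCompact hB (by fun_prop) (by fun_prop)
          fun x _ => pow_mul_sub_le_pow_succ (by positivity) hη0.le j
    _ = ∫ y in R • B, Real.exp (n * u y) := (setIntegral_smul_exp_eq hn u B hR0).symm
    _ ≤ ∫ y in {y : E n | r < ‖y‖}, Real.exp (n * u y) :=
        setIntegral_mono_set hi.integrableOn (ae_of_all _ fun y => (Real.exp_pos _).le)
          (LE.le.eventuallyLE (by rintro _ ⟨x, hx, rfl⟩; exact hRB x hx))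

theorem IsLogPotential.exists_le_setIntegral_exp (hn : 2 < n) (h : IsLogPotential u f) {C : ℝ}
    (hS : ∀ᶠ x in cocompact (E n),
      0 ≤ scalarDensity u x ∧ scalarDensity u x ≤ C * Real.exp (2 * u x))
    (hα : ∫ y, f y ≠ 2) : ∃ B : Set (E n), IsCompact B ∧ 0 ∉ B ∧ ∃ c : ℝ, 0 < c ∧
      ∀ᶠ R : ℝ in atTop, c ≤ ∫ x in B, R ^ 2 * Real.exp (2 * u (R • x)) := by
  obtain ⟨φ, hφ, hc, h0, hφ0, hφ1, hvol, hI⟩ :=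
    exists_bump_zero_notMem_tsupport (by omega : 0 < n)
  obtain ⟨hα0, hα2⟩ := h.total_mem_Icc hn (hS.mono fun x hx => hx.1)
  refine ⟨tsupport φ, hc, h0, ?_⟩
  rcases hα0.eq_or_lt with hzero | hpos
  · exact h.exists_le_setIntegral_exp_of_total_eq_zero (by omega) hc h0 hvol hzero.symm
  · exact h.exists_le_setIntegral_exp_of_total_mem_Ioo hn (hS.mono fun x hx => hx.2) hφ hc h0 hφ0
      hφ1 hI ⟨hpos, hα2.lt_of_ne hα⟩

theorem IsLogPotential.total_le_one_or_eq_two (hn : 2 < n) (h : IsLogPotential u f) {C : ℝ}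
    (hS : ∀ᶠ x in cocompact (E n),
      0 ≤ scalarDensity u x ∧ scalarDensity u x ≤ C * Real.exp (2 * u x)) :
    ∫ y, f y ≤ 1 ∨ ∫ y, f y = 2 := by
  by_contra! hα
  obtain ⟨B, hB, h0, c, hc, hcR⟩ := h.exists_le_setIntegral_exp hn hS hα.2
  exact (ge_of_tendsto (h.tendsto_setIntegral_exp (by omega) hB h0 hα.1) hcR).not_gt hc

theorem IsLogPotential.total_eq_two_of_integrable_exp (hn : 2 < n) (hne : Even n)
    (h : IsLogPotential u f) {C : ℝ}
    (hS : ∀ᶠ x in cocompact (E n),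
      0 ≤ scalarDensity u x ∧ scalarDensity u x ≤ C * Real.exp (2 * u x))
    (hexp : Integrable fun x => Real.exp (n * u x)) : ∫ y, f y = 2 := by
  by_contra hα
  obtain ⟨B, hB, h0, c, hc, hcR⟩ := h.exists_le_setIntegral_exp hn hS hα
  obtain ⟨j, hj⟩ : ∃ j, n = 2 * (j + 1) := by
    obtain ⟨m, hm⟩ := hne
    exact ⟨m - 1, by omega⟩
  exact not_integrable_exp_of_le_setIntegral hj h.contDiff.continuous hB h0 hc hcR hexp

end Quantization

section QCurvature

variable {u : E n → ℝ}

/-- The function `Q e^{nu}`, for `Q` the Q-curvature of `e^{2u} |dx|²`, divided by `critConst n`,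
so that the round sphere has total mass `2`. -/
def normalizedQDensity (u : E n → ℝ) (x : E n) : ℝ :=
  (critConst n)⁻¹ * (qCurvature u x * Real.exp (n * u x))

theorem integral_qCurvature_mul_exp (u : E n → ℝ) :
    ∫ x, qCurvature u x * Real.exp (n * u x) = critConst n * ∫ x, normalizedQDensity u x := by
  simp only [normalizedQDensity]
  rw [integral_const_mul, mul_inv_cancel_left₀ (critConst_pos n).ne']

theorem qCurvature_mul_exp {k : ℕ} (hn : n = 2 * (k + 2)) (hu : ContDiff ℝ ∞ u) (x : E n) :
    qCurvature u x * Real.exp (n * u x) = (-1) ^ k * (Δ^[k + 2] u) x := by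
  rw [qCurvature, show n / 2 = k + 2 by omega, negLaplacianPow_eq_iterate_laplacian _ hu,
    mul_right_comm, ← Real.exp_add, neg_add_cancel, Real.exp_zero, one_mul, Pi.smul_apply,
    smul_eq_mul, pow_add, neg_one_sq, mul_one]

theorem scalarDensity_nonneg_and_le (hn : 1 < n) (hu : ContDiff ℝ ∞ u) {C : ℝ}
    (hR : ∀ᶠ x in cocompact (E n), 0 ≤ scalarCurvature (conformalMetric u) x ∧
      scalarCurvature (conformalMetric u) x ≤ C) :
    ∀ᶠ x in cocompact (E n), 0 ≤ scalarDensity u x ∧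
      scalarDensity u x ≤ C / (2 * ((n : ℝ) - 1)) * Real.exp (2 * u x) := by
  have hn' : 0 < 2 * ((n : ℝ) - 1) := mul_pos two_pos (sub_pos.2 (by exact_mod_cast hn))
  filter_upwards [hR] with x ⟨h0, hC⟩
  have hdensity : scalarDensity u x
      = scalarCurvature (conformalMetric u) x / (2 * ((n : ℝ) - 1)) * Real.exp (2 * u x) := by
    rw [div_mul_eq_mul_div, scalarCurvature_conformalMetric_mul_exp_eq_scalarDensity hu,
      mul_div_cancel_left₀ _ hn'.ne']
  rw [hdensity]
  exact ⟨by positivity, by gcongr⟩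

theorem exists_setIntegral_norm_gradient_le_of_scalarDensity_nonneg (hn : 4 ≤ n)
    (hu : ContDiff ℝ ∞ u) (hS : ∀ᶠ x in cocompact (E n), 0 ≤ scalarDensity u x) :
    ∃ C : ℝ, ∀ R : ℝ, 1 ≤ R → ∫ x in closedBall 0 R, ‖∇ u x‖ ≤ C * R ^ (n - 1) := by
  refine exists_setIntegral_norm_gradient_le (by omega) hu (hS.mono fun x hx => ?_)
  have hn' : (4 : ℝ) ≤ n := by exact_mod_cast hn
  rw [scalarDensity] at hx
  nlinarith [mul_nonneg (sub_nonneg.2 hn') (sq_nonneg ‖∇ u x‖)]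

theorem isLogPotential_normalizedQDensity (hn : 4 ≤ n) (hne : Even n) (hu : ContDiff ℝ ∞ u)
    (hQ : Integrable fun x => qCurvature u x * Real.exp (n * u x))
    (hS : ∀ᶠ x in cocompact (E n), 0 ≤ scalarDensity u x) :
    IsLogPotential u (normalizedQDensity u) := by
  obtain ⟨k, hk⟩ : ∃ k, n = 2 * (k + 2) := by
    obtain ⟨m, hm⟩ := hne
    exact ⟨m - 2, by omega⟩
  obtain ⟨A, hA⟩ := exists_setIntegral_norm_gradient_le_of_scalarDensity_nonneg hn hu hS
  have hdensity : normalizedQDensity u = fun x => (critConst n)⁻¹ * ((-1) ^ k * (Δ^[k + 2] u) x) :=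
    funext fun x => by rw [normalizedQDensity, qCurvature_mul_exp hk hu]
  have hF : Integrable (Δ^[k + 2] u) := by
    refine (hQ.const_mul ((-1) ^ k)).congr (ae_of_all _ fun x => ?_)
    simp only [qCurvature_mul_exp hk hu]
    rw [← mul_assoc, ← mul_pow, neg_one_mul, neg_neg, one_pow, one_mul]
  have hc : Continuous (normalizedQDensity u) := by
    have := (contDiff_iterate_laplacian (k + 2) hu).continuous
    rw [hdensity]
    fun_prop
  have hi : Integrable (normalizedQDensity u) := hQ.const_mul _
  refine ⟨hu, hi, hc, fun x => ?_⟩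
  ext i
  have hcoord : ∫ y, (normalizedQDensity u y • rieszKernel (y - x)) i
      = (∫ y, normalizedQDensity u y • rieszKernel (y - x)) i :=
    (EuclideanSpace.proj (𝕜 := ℝ) i).integral_comp_comm
      (integrable_smul_rieszKernel (by omega) hi hc x)
  rw [gradient_apply, ← hcoord, ← mul_right_inj' (critConst_pos n).ne',
    critConst_mul_partialDeriv hk hu hF hA i x, ← integral_const_mul]
  refine integral_congr_ae (ae_of_all _ fun y => ?_)
  simp only [hdensity, rieszKernel, PiLp.smul_apply, smul_eq_mul]
  rw [← mul_assoc (critConst n), mul_inv_cancel_left₀ (critConst_pos n).ne']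
  ring

end QCurvature

end ConformalQ

end

open ConformalQ in
theorem mainTheorem5 (n : ℕ) (hn : 4 ≤ n) (hne : Even n)
    (u : EuclideanSpace ℝ (Fin n) → ℝ) (hu : ContDiff ℝ ∞ u)
    (hQ : Integrable (fun x => ConformalQ.qCurvature u x * Real.exp (n * u x)) volume)
    (C : ℝ)
    (hR : ∀ᶠ x in Filter.cocompact (EuclideanSpace ℝ (Fin n)),
      0 ≤ ConformalQ.scalarCurvature (ConformalQ.conformalMetric u) x ∧
        ConformalQ.scalarCurvature (ConformalQ.conformalMetric u) x ≤ C) :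
    ((0 ≤ (∫ x, ConformalQ.qCurvature u x * Real.exp (n * u x)) ∧
        (∫ x, ConformalQ.qCurvature u x * Real.exp (n * u x))
          ≤ ((n - 1).factorial : ℝ) * ConformalQ.sphereVolume n / 2) ∨
      (∫ x, ConformalQ.qCurvature u x * Real.exp (n * u x))
        = ((n - 1).factorial : ℝ) * ConformalQ.sphereVolume n) ∧
    (Integrable (fun x => Real.exp (n * u x)) volume →
      (∫ x, ConformalQ.qCurvature u x * Real.exp (n * u x))
        = ((n - 1).factorial : ℝ) * ConformalQ.sphereVolume n) := by
  have hS := scalarDensity_nonneg_and_le (by omega) hu hR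
  have hlog := isLogPotential_normalizedQDensity hn hne hu hQ (hS.mono fun x hx => hx.1)
  have hγ := critConst_pos n
  have hhalf : ((n - 1).factorial : ℝ) * sphereVolume n / 2 = critConst n * 1 := by
    rw [critConst, mul_one]
  have htotal : ((n - 1).factorial : ℝ) * sphereVolume n = critConst n * 2 := by
    rw [critConst, div_mul_cancel₀ _ two_ne_zero]
  rw [hhalf, htotal, integral_qCurvature_mul_exp, mul_nonneg_iff_of_pos_left hγ,
    mul_le_mul_iff_right₀ hγ, mul_right_inj' hγ.ne']
  exact ⟨(hlog.total_le_one_or_eq_two (by omega) hS).imp_left fun hle =>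
      ⟨(hlog.total_mem_Icc (by omega) (hS.mono fun x hx => hx.1)).1, hle⟩,
    hlog.total_eq_two_of_integrable_exp (by omega) hne hS⟩
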